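/- Let $(R,\mathfrak m)$ be a commutative Noetherian local ring. A finitely generated $R$-module $C$ is *semidualizing* if the homothety map $R\to \operatorname{Hom}_R(C,C)$ is an isomorphism and $\operatorname{Ext}^i_R(C,C)=0$ for all $i>0$. A finitely generated $R$-module $G$ is *totally $C$-reflexive* if the evaluation map $G\to\operatorname{Hom}_R(\operatorname{Hom}_R(G,C),C)$ is an isomorphism and $\operatorname{Ext}^i_R(G,C)=0=\operatorname{Ext}^i_R(\operatorname{Hom}_R(G,C),C)$ for all $i>0$. The $G_C$-*dimension* of an $R$-module $M$ is the least $n\ge 0$ for which there is an exact sequence $0\to G_n\to\cdots\to G_0\to M\to 0$ with every $G_i$ totally $C$-reflexive, and $\infty$ if there is no such $n$. A nonzero finitely generated $R$-module $M$ is *Cohen–Macaulay* if $\operatorname{depth}_R M=\dim_R M$, where $\operatorname{depth}_R M$ is the supremum of the lengths of the $M$-regular sequences in $\mathfrak m$ and $\dim_R M$ is the Krull dimension of the support of $M$; its *type* is $\dim_{R/\mathfrak m}\operatorname{Ext}^n_R(R/\mathfrak m,M)$, where $n=\operatorname{depth}_R M$. The ring $R$ is Cohen–Macaulay if it is so as an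 $R$-module. **Corollary 3.5.** Let $C$ be a semidualizing $R$-module. If there exists a Cohen–Macaulay $R$-module of type $1$ and of finite $G_C$-dimension, then $R$ is Cohen–Macaulay. -/

import Mathlib

universe u

noncomputable section

namespace LocalAlg

open CategoryTheory CategoryTheory.Abelian IsLocalRing

section General

variable (R : Type u) [CommRing R]

/-- The group `Ext^i_R(M, N)` of two `R`-modules (with its `R`-module structure). -/
abbrev ExtMod (M N : Type u) [AddCommGroup M] [Module R M] [AddCommGroup N] [Module R N]
    (i : ℕ) : Type u :=
  Ext (ModuleCat.of R M) (ModuleCat.of R N) i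

/-- A finitely generated `R`-module `C` is semidualizing if the homothety map
`R → Hom_R(C, C)` is an isomorphism and `Ext^i_R(C, C) = 0` for all `i > 0`. -/
structure IsSemidualizing (C : Type u) [AddCommGroup C] [Module R C] : Prop where
  finite : Module.Finite R C
  homothety_bijective : Function.Bijective (LinearMap.lsmul R C : R →ₗ[R] (C →ₗ[R] C))
  ext_self : ∀ i : ℕ, 0 < i → Subsingleton (ExtMod R C C i)

/-- A finitely generated `R`-module `M` is totally `C`-reflexive if the evaluation map
`M → Hom_R(Hom_R(M, C), C)` is an isomorphism and
`Ext^i_R(M, C) = 0 = Ext^i_R(Hom_R(M, C), C)` for all `i > 0`. -/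
structure IsTotallyReflexive (C M : Type u) [AddCommGroup C] [Module R C]
    [AddCommGroup M] [Module R M] : Prop where
  finite : Module.Finite R M
  eval_bijective :
    Function.Bijective (LinearMap.applyₗ : M →ₗ[R] ((M →ₗ[R] C) →ₗ[R] C))
  ext_left : ∀ i : ℕ, 0 < i → Subsingleton (ExtMod R M C i)
  ext_dual : ∀ i : ℕ, 0 < i → Subsingleton (ExtMod R (M →ₗ[R] C) C i)

/-- `M` has `G_C`-dimension at most `n`: there is an exact sequence
`0 → G_n → ⋯ → G_1 → G_0 → M → 0` with every `G_i` totally `C`-reflexive.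
The sequence is indexed by all natural numbers, with `G_i = 0` for `i > n`. -/
def GCDimLE (C M : Type u) [AddCommGroup C] [Module R C] [AddCommGroup M] [Module R M]
    (n : ℕ) : Prop :=
  ∃ (G : ℕ → ModuleCat.{u} R) (d : ∀ i : ℕ, G (i + 1) →ₗ[R] G i) (ε : G 0 →ₗ[R] M),
    (∀ i : ℕ, IsTotallyReflexive R C (G i)) ∧
    (∀ i : ℕ, n < i → Subsingleton (G i)) ∧
    Function.Surjective ε ∧
    Function.Exact (d 0) ε ∧
    ∀ i : ℕ, Function.Exact (d (i + 1)) (d i)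

/-- The `G_C`-dimension of `M`: the least `n` such that `M` has `G_C`-dimension at most `n`,
and `⊤` if there is none. -/
def gcDim (C M : Type u) [AddCommGroup C] [Module R C] [AddCommGroup M] [Module R M] : ℕ∞ :=
  ⨅ (n : ℕ) (_ : GCDimLE R C M n), (n : ℕ∞)

end General

section Local

variable (R : Type u) [CommRing R] [IsLocalRing R]

/-- The depth of a finitely generated module `M` over a (Noetherian) local ring: the supremum of
the lengths of the `M`-regular sequences in the maximal ideal. (If `M ≠ 0`, then a weakly regular
sequence in the maximal ideal is regular, by Nakayama's lemma; if `M = 0`, the depth is `⊤`.) -/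
def depth (M : Type u) [AddCommGroup M] [Module R M] : ℕ∞ :=
  ⨆ (rs : List R) (_ : (∀ r ∈ rs, r ∈ maximalIdeal R) ∧
    RingTheory.Sequence.IsWeaklyRegular M rs), (rs.length : ℕ∞)

/-- A Cohen-Macaulay module over a (Noetherian) local ring: a nonzero finitely generated module
whose depth equals the Krull dimension of its support. -/
structure IsCohenMacaulay (M : Type u) [AddCommGroup M] [Module R M] : Prop where
  finite : Module.Finite R M
  nontrivial : Nontrivial M
  depth_eq : (depth R M : WithBot ℕ∞) = Module.supportDim R M

/-- `Ext^n_R(R/𝔪, M)` is annihilated by the maximal ideal `𝔪`. -/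
theorem isTorsionBySet_ext (M : Type u) [AddCommGroup M] [Module R M] (n : ℕ) :
    Module.IsTorsionBySet R (ExtMod R (ResidueField R) M n)
      (maximalIdeal R : Set R) := by
  rintro x ⟨a, ha⟩
  have h0 : a • 𝟙 (ModuleCat.of R (ResidueField R)) = 0 := by
    ext y
    obtain ⟨b, rfl⟩ := residue_surjective y
    change a • residue R b = 0
    rw [Algebra.smul_def, ResidueField.algebraMap_eq, (residue_eq_zero_iff a).2 ha, zero_mul]
  have h1 : a • x = (Ext.mk₀ (a • 𝟙 (ModuleCat.of R (ResidueField R)))).comp x (zero_add n) := by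
    simp [Ext.mk₀_smul]
  change a • x = 0
  rw [h1, h0]
  simp

/-- The vector space structure of `Ext^n_R(R/𝔪, M)` over `R/𝔪`, induced by its `R`-module
structure. -/
instance residueFieldModuleExt (M : Type u) [AddCommGroup M] [Module R M] (n : ℕ) :
    Module (ResidueField R) (ExtMod R (ResidueField R) M n) :=
  (isTorsionBySet_ext R M n).module

/-- The type of a nonzero finitely generated module `M` of depth `n`: the dimension of
`Ext^n_R(R/𝔪, M)` over `R/𝔪`. -/
def moduleType (M : Type u) [AddCommGroup M] [Module R M] : ℕ :=
  Module.finrank (ResidueField R) (ExtMod R (ResidueField R) M (depth R M).toNat)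

end Local

end LocalAlg

end

noncomputable section

namespace LocalAlg

open CategoryTheory CategoryTheory.Abelian IsLocalRing

/-! ### Vanishing of `Ext` along short exact sequences, and their `C`-duals. -/

section Sequences

variable {R : Type u} [CommRing R]

/-! Write `k` for the residue field, `t` for the depth of `M`, and `d` for the least degree with
`Ext^d(k, C) ≠ 0`. The engine is a duality (`IsDualizedBy`): if `X` has a resolution of length `j`
by totally reflexive modules and `Ext^i(Y, C) = 0` for `i < d`, then the Yoneda product identifies
`Ext^(d-j)(Y, X)` with `Hom(Ext^j(X, C), Ext^d(Y, C))`, and `Ext^i(Y, X) = 0` for `i < d - j`.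

An Auslander–Bridger argument (`HasReflexiveResolution.of_depth`) allows `j = d - t` for `X = M`.
With `Y = k`, type one of `M` forces `Ext^d(k, C)` to have length at most one. Dividing `M` by a
maximal regular sequence gives `X ≠ 0` of finite length, dual in codegree `d`. With `Y = R/ann X`
the duality embeds `X` in `Hom(Ext^d(X, C), Ext^d(Y, C))`; as the socle of `Ext^d(Y, C)` has length
at most one, `ℓ(X) ≤ ℓ(Ext^d(X, C))`.

Since `ℓ(Ext^d(V, C)) ≤ ℓ(V)` for all `V` of finite length, this leaves no room in the long exact
sequence of `0 → V → X → k → 0`, and `Ext^i(k, C) = 0` for all `i > d`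
(`subsingleton_ext_residueField_of_length`). But `C` is faithful, so `Ext^n(k, C) ≠ 0` for `n = dim
R` (`nontrivial_ext_of_ringKrullDim`); hence `dim R ≤ d`. Finally `R ≅ Hom(C, C)` has depth at least
`d`. -/

theorem shortExact_of_linearMap {A B D : Type u} [AddCommGroup A] [Module R A] [AddCommGroup B]
    [Module R B] [AddCommGroup D] [Module R D] {f : A →ₗ[R] B} {g : B →ₗ[R] D}
    (hf : Function.Injective f) (h : Function.Exact f g) (hg : Function.Surjective g) :
    (ModuleCat.shortComplexOfCompEqZero f g h.linearMap_comp_eq_zero).ShortExact where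
  exact := ModuleCat.shortComplex_exact _ h
  mono_f := (ModuleCat.mono_iff_injective _).2 hf
  epi_g := (ModuleCat.epi_iff_surjective _).2 hg

variable {S : ShortComplex (ModuleCat.{u} R)} (hS : S.ShortExact) (Y : ModuleCat.{u} R)
include hS

theorem exact_of_shortExact : Function.Exact S.f S.g :=
  (ShortComplex.ShortExact.moduleCat_exact_iff_function_exact S).1 hS.exact

theorem subsingleton_ext_X₁_of_covariant {n : ℕ} (h₃ : Subsingleton (Ext Y S.X₃ n))
    (h₂ : Subsingleton (Ext Y S.X₂ (n + 1))) : Subsingleton (Ext Y S.X₁ (n + 1)) := by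
  refine subsingleton_of_forall_eq 0 fun x ↦ ?_
  obtain ⟨y, rfl⟩ := Ext.covariant_sequence_exact₁ Y hS x (Subsingleton.elim _ _) rfl
  rw [Subsingleton.elim y 0, Ext.zero_comp]

theorem subsingleton_ext_zero_X₁ (h₂ : Subsingleton (Ext Y S.X₂ 0)) :
    Subsingleton (Ext Y S.X₁ 0) := by
  have := hS.mono_f
  exact (Ext.postcomp_mk₀_injective_of_mono Y S.f).subsingleton

theorem subsingleton_ext_X₃_of_covariant {n : ℕ} (h₂ : Subsingleton (Ext Y S.X₂ n))
    (h₁ : Subsingleton (Ext Y S.X₁ (n + 1))) : Subsingleton (Ext Y S.X₃ n) := by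
  refine subsingleton_of_forall_eq 0 fun x ↦ ?_
  obtain ⟨y, rfl⟩ := Ext.covariant_sequence_exact₃ Y hS x rfl (Subsingleton.elim _ _)
  rw [Subsingleton.elim y 0, Ext.zero_comp]

theorem subsingleton_ext_X₁_of_contravariant {n : ℕ} (h₂ : Subsingleton (Ext S.X₂ Y n))
    (h₃ : Subsingleton (Ext S.X₃ Y (n + 1))) : Subsingleton (Ext S.X₁ Y n) := by
  refine subsingleton_of_forall_eq 0 fun x ↦ ?_
  obtain ⟨y, rfl⟩ := Ext.contravariant_sequence_exact₁ hS Y x (add_comm 1 n)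
    (Subsingleton.elim _ _)
  rw [Subsingleton.elim y 0, Ext.comp_zero]

theorem subsingleton_ext_X₂_of_contravariant {n : ℕ} (h₁ : Subsingleton (Ext S.X₁ Y n))
    (h₃ : Subsingleton (Ext S.X₃ Y n)) : Subsingleton (Ext S.X₂ Y n) := by
  refine subsingleton_of_forall_eq 0 fun x ↦ ?_
  obtain ⟨y, rfl⟩ := Ext.contravariant_sequence_exact₂ hS Y x (Subsingleton.elim _ _)
  rw [Subsingleton.elim y 0, Ext.comp_zero]

theorem subsingleton_ext_X₃_of_contravariant {n : ℕ} (h₁ : Subsingleton (Ext S.X₁ Y n))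
    (h₂ : Subsingleton (Ext S.X₂ Y (n + 1))) : Subsingleton (Ext S.X₃ Y (n + 1)) := by
  refine subsingleton_of_forall_eq 0 fun x ↦ ?_
  obtain ⟨y, rfl⟩ := Ext.contravariant_sequence_exact₃ hS Y x (Subsingleton.elim _ _)
    (add_comm 1 n)
  rw [Subsingleton.elim y 0, Ext.comp_zero]

theorem exists_extension_of_subsingleton_ext_one (h : Subsingleton (Ext S.X₃ Y 1))
    (φ : S.X₁ →ₗ[R] Y) : ∃ ψ : S.X₂ →ₗ[R] Y, ∀ x, ψ (S.f x) = φ x := by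
  obtain ⟨e, he⟩ := Ext.contravariant_sequence_exact₁ hS Y (Ext.mk₀ (ModuleCat.ofHom φ))
    (add_zero 1) (Subsingleton.elim _ _)
  obtain ⟨ψ, rfl⟩ := Ext.mk₀_bijective _ _ |>.2 e
  rw [Ext.mk₀_comp_mk₀] at he
  have := (Ext.mk₀_bijective _ _).1 he
  exact ⟨ψ.hom, fun x ↦ congr($this x)⟩

theorem exists_factor_of_apply_eq_zero (φ : S.X₂ →ₗ[R] Y) (h : ∀ x, φ (S.f x) = 0) :
    ∃ ψ : S.X₃ →ₗ[R] Y, ∀ x, ψ (S.g x) = φ x := by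
  have hs : Function.Surjective S.g.hom := hS.surjective_g
  have hk : LinearMap.ker S.g.hom ≤ LinearMap.ker φ := by
    intro x hx
    obtain ⟨y, rfl⟩ := (exact_of_shortExact hS x).1 hx
    exact h y
  refine ⟨((LinearMap.ker S.g.hom).liftQ φ hk).comp
    (S.g.hom.quotKerEquivOfSurjective hs).symm.toLinearMap, fun x ↦ ?_⟩
  have : (S.g.hom.quotKerEquivOfSurjective hs).symm (S.g x) = Submodule.Quotient.mk x := by
    rw [LinearEquiv.symm_apply_eq]; rfl
  simp [this]

/-- The `C`-dual of a short exact sequence `0 → K → F → L → 0` is short exact if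
`Ext^1(L, C) = 0`. -/
theorem shortExact_dual (h : Subsingleton (Ext S.X₃ Y 1)) :
    (ModuleCat.shortComplexOfCompEqZero (LinearMap.lcomp R Y S.g.hom) (LinearMap.lcomp R Y S.f.hom)
      (by ext φ x; simp)).ShortExact := by
  refine shortExact_of_linearMap ?_ ?_ ?_
  · intro φ ψ hφ
    ext x
    obtain ⟨y, rfl⟩ := hS.surjective_g x
    exact congr($hφ y)
  · intro φ
    constructor
    · intro hφ
      obtain ⟨ψ, hψ⟩ := exists_factor_of_apply_eq_zero hS Y φ fun x ↦ congr($hφ x)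
      exact ⟨ψ, LinearMap.ext hψ⟩
    · rintro ⟨ψ, rfl⟩
      ext x
      simp
  · intro φ
    obtain ⟨ψ, hψ⟩ := exists_extension_of_subsingleton_ext_one hS Y h φ
    exact ⟨ψ, LinearMap.ext hψ⟩

end Sequences

/-! ### The comparison of `Ext^i(Y, Hom(L, C))` with `Hom(L, Ext^i(Y, C))`. -/

section Pairing

variable {R : Type u} [CommRing R]

/-- Evaluation at `l`, as a morphism from the `C`-dual of `L` to `C`. -/
abbrev evalHom (C : ModuleCat.{u} R) {L : Type u} [AddCommGroup L] [Module R L] (l : L) :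
    ModuleCat.of R (L →ₗ[R] C) ⟶ C :=
  ModuleCat.ofHom (LinearMap.applyₗ l)

/-- The morphism `C ⟶ Hom(L, C)` induced by a linear form on `L`. -/
abbrev coevalHom (C : ModuleCat.{u} R) {L : Type u} [AddCommGroup L] [Module R L]
    (p : L →ₗ[R] R) : C ⟶ ModuleCat.of R (L →ₗ[R] C) :=
  ModuleCat.ofHom (LinearMap.smulRightₗ p)

theorem coevalHom_evalHom (C : ModuleCat.{u} R) {L : Type u} [AddCommGroup L] [Module R L]
    (p : L →ₗ[R] R) (l : L) : coevalHom C p ≫ evalHom C l = p l • 𝟙 C := by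
  ext c
  simp

theorem lcomp_evalHom (C : ModuleCat.{u} R) {L L' : ModuleCat.{u} R} (f : L' ⟶ L) (l : L') :
    ModuleCat.ofHom (LinearMap.lcomp R C f.hom) ≫ evalHom C l = evalHom C (f l) := by
  ext c
  simp

variable {Y C : ModuleCat.{u} R}

/-- A basis `b` of `F` decomposes the identity of `Hom(F, C)` into evaluations at the `b j` followed
by the maps induced by the coordinate forms. -/
theorem eq_zero_of_comp_evalHom_of_free {F : Type u} [AddCommGroup F] [Module R F]
    [Module.Free R F] [Module.Finite R F] {i : ℕ} (e : Ext Y (ModuleCat.of R (F →ₗ[R] C)) i)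
    (he : ∀ l, e.comp (Ext.mk₀ (evalHom C l)) (add_zero i) = 0) : e = 0 := by
  let b := Module.Free.chooseBasis R F
  have h : 𝟙 (ModuleCat.of R (F →ₗ[R] C)) = ∑ j, evalHom C (b j) ≫ coevalHom C (b.coord j) := by
    ext φ x
    have := congr(φ $(b.sum_repr x))
    rw [map_sum] at this
    simp only [map_smul] at this
    simpa [ModuleCat.hom_sum, LinearMap.sum_apply] using this.symm
  rw [← Ext.comp_mk₀_id e, h, Ext.mk₀_sum, Ext.comp_sum]
  refine Finset.sum_eq_zero fun j _ ↦ ?_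
  rw [← Ext.mk₀_comp_mk₀, ← Ext.comp_assoc_of_third_deg_zero, he, Ext.zero_comp]

theorem exists_comp_evalHom_of_free {F : Type u} [AddCommGroup F] [Module R F]
    [Module.Free R F] [Module.Finite R F] {i : ℕ} (φ : F →ₗ[R] Ext Y C i) :
    ∃ e : Ext Y (ModuleCat.of R (F →ₗ[R] C)) i,
      ∀ l, e.comp (Ext.mk₀ (evalHom C l)) (add_zero i) = φ l := by
  let b := Module.Free.chooseBasis R F
  refine ⟨∑ j, (φ (b j)).comp (Ext.mk₀ (coevalHom C (b.coord j))) (add_zero i), fun l ↦ ?_⟩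
  have : ∀ j, ((φ (b j)).comp (Ext.mk₀ (coevalHom C (b.coord j))) (add_zero i)).comp
      (Ext.mk₀ (evalHom C l)) (add_zero i) = b.coord j l • φ (b j) := by
    intro j
    rw [Ext.comp_assoc_of_third_deg_zero, Ext.mk₀_comp_mk₀, coevalHom_evalHom, Ext.mk₀_smul,
      Ext.comp_smul, Ext.comp_mk₀_id]
  rw [Ext.sum_comp, Finset.sum_congr rfl fun j _ ↦ this j]
  have := congr(φ $(b.sum_repr l))
  rw [map_sum] at this
  simpa only [map_smul, Module.Basis.coord_apply] using this

/-- Vanishing of `Ext` into `C` passes to syzygies, so inductions can replace `L` by `K`. -/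
theorem exists_finite_free_cover [IsNoetherianRing R] (C L : ModuleCat.{u} R) [Module.Finite R L]
    (hL : ∀ i, 0 < i → Subsingleton (Ext L C i)) :
    ∃ (K F : ModuleCat.{u} R) (ι : K ⟶ F) (π : F ⟶ L) (w : ι ≫ π = 0),
      (ShortComplex.mk ι π w).ShortExact ∧ Module.Free R F ∧ Module.Finite R F ∧
      Module.Finite R K ∧ ∀ i, 0 < i → Subsingleton (Ext K C i) := by
  obtain ⟨F, _, _, _, _, π, hπ⟩ := Module.exists_finite_presentation R L
  have hS := LinearMap.shortExact_shortComplexKer hπ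
  refine ⟨_, _, _, _, _, hS, ‹_›, ‹_›, inferInstanceAs (Module.Finite R (LinearMap.ker π)),
    fun i hi ↦ ?_⟩
  refine subsingleton_ext_X₁_of_contravariant hS C
    (subsingleton_of_forall_eq 0 fun x ↦ ?_) (hL _ (by omega))
  obtain ⟨i, rfl⟩ := Nat.exists_eq_succ_of_ne_zero hi.ne'
  exact Ext.eq_zero_of_projective x

variable [IsNoetherianRing R] {d : ℕ} (hY : ∀ i < d, Subsingleton (Ext Y C i))
include hY

/-- Dualize `0 → K → F → L → 0`. The free case kills the image of `e` in `Ext(Y, Hom(F, C))`, so `e`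
comes from `Hom(K, C)` one degree lower; there the evaluations land in a zero group and induction
applies. -/
theorem eq_zero_of_comp_evalHom {i : ℕ} (hi : i ≤ d) {L : ModuleCat.{u} R} [Module.Finite R L]
    (hL : ∀ i, 0 < i → Subsingleton (Ext L C i)) (e : Ext Y (ModuleCat.of R (L →ₗ[R] C)) i)
    (he : ∀ l : L, e.comp (Ext.mk₀ (evalHom C l)) (add_zero i) = 0) : e = 0 := by
  induction i generalizing L with
  | zero =>
    obtain ⟨φ, rfl⟩ := (Ext.mk₀_bijective _ _).2 e
    simp only [Ext.mk₀_comp_mk₀, Ext.mk₀_eq_zero_iff] at he ⊢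
    ext y l
    exact congr($(he l) y)
  | succ i ih =>
    obtain ⟨K, F, ι, π, w, hS, _, _, _, hK⟩ := exists_finite_free_cover C L hL
    have hdual := shortExact_dual hS C (hL 1 one_pos)
    have h0 : e.comp (Ext.mk₀ (ModuleCat.ofHom (LinearMap.lcomp R C π.hom))) (add_zero _) = 0 := by
      refine eq_zero_of_comp_evalHom_of_free _ fun l ↦ ?_
      rw [Ext.comp_assoc_of_third_deg_zero, Ext.mk₀_comp_mk₀, lcomp_evalHom]
      exact he _
    obtain ⟨e', rfl⟩ := Ext.covariant_sequence_exact₁ Y hdual e h0 rfl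
    have := hY i (by omega)
    rw [ih (by omega) hK e' fun l ↦ Subsingleton.elim _ _, Ext.zero_comp]

theorem subsingleton_ext_dual {i : ℕ} (hi : i < d) {L : ModuleCat.{u} R} [Module.Finite R L]
    (hL : ∀ i, 0 < i → Subsingleton (Ext L C i)) :
    Subsingleton (Ext Y (ModuleCat.of R (L →ₗ[R] C)) i) := by
  have := hY i hi
  exact subsingleton_of_forall_eq 0 fun e ↦
    eq_zero_of_comp_evalHom hY hi.le hL e fun l ↦ Subsingleton.elim _ _

/-- Solve the problem on a free cover `F`. The obstruction to descending to `L` lies in `Ext^d(Y,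
Hom(K, C))`, where evaluations detect zero, and they vanish because `φ ∘ π` kills `K`. -/
theorem exists_comp_evalHom {L : ModuleCat.{u} R} [Module.Finite R L]
    (hL : ∀ i, 0 < i → Subsingleton (Ext L C i)) (φ : L →ₗ[R] Ext Y C d) :
    ∃ e : Ext Y (ModuleCat.of R (L →ₗ[R] C)) d,
      ∀ l : L, e.comp (Ext.mk₀ (evalHom C l)) (add_zero d) = φ l := by
  obtain ⟨K, F, ι, π, w, hS, _, _, _, hK⟩ := exists_finite_free_cover C L hL
  have hdual := shortExact_dual hS C (hL 1 one_pos)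
  obtain ⟨e₀, he₀⟩ := exists_comp_evalHom_of_free (φ.comp π.hom)
  have h0 : e₀.comp (Ext.mk₀ (ModuleCat.ofHom (LinearMap.lcomp R C ι.hom))) (add_zero _) = 0 := by
    refine eq_zero_of_comp_evalHom hY le_rfl hK _ fun l ↦ ?_
    rw [Ext.comp_assoc_of_third_deg_zero, Ext.mk₀_comp_mk₀, lcomp_evalHom]
    refine (he₀ _).trans ?_
    have : π (ι l) = 0 := congr($w l)
    rw [LinearMap.comp_apply, this, map_zero]
  obtain ⟨e, he⟩ := Ext.covariant_sequence_exact₂ Y hdual e₀ h0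
  refine ⟨e, fun l ↦ ?_⟩
  obtain ⟨x, rfl⟩ := (hS.moduleCat_surjective_g : Function.Surjective π) l
  have h1 := he₀ x
  rw [← he, Ext.comp_assoc_of_third_deg_zero] at h1
  rw [← lcomp_evalHom, ← Ext.mk₀_comp_mk₀]
  exact h1

end Pairing

end LocalAlg

end

noncomputable section

namespace LocalAlg

open CategoryTheory CategoryTheory.Abelian IsLocalRing

/-! ### The duality between `Ext(Y, X)` and `Ext(X, C)`. -/

section Duality

variable {R : Type u} [CommRing R]

/-- `X` satisfies duality with respect to `C` in codegree `j`, as seen by `Y`: the groups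
`Ext^l(X, C)` vanish for `l > j`, the groups `Ext^i(Y, X)` vanish for `i + j < d`, and for
`i + j = d` the Yoneda product identifies `Ext^i(Y, X)` with
`Hom(Ext^j(X, C), Ext^d(Y, C))`. -/
structure IsDualizedBy (C Y : ModuleCat.{u} R) (d j : ℕ) (X : ModuleCat.{u} R) : Prop where
  ext_zero : ∀ l, j < l → Subsingleton (Ext X C l)
  low : ∀ i, i + j < d → Subsingleton (Ext Y X i)
  inj : ∀ (i : ℕ) (h : i + j = d) (e : Ext Y X i), (∀ f : Ext X C j, e.comp f h = 0) → e = 0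
  surj : ∀ (i : ℕ) (h : i + j = d) (φ : Ext X C j →ₗ[R] Ext Y C d),
    ∃ e : Ext Y X i, ∀ f, e.comp f h = φ f

/-- Apply the comparison to `L = Hom(G, C)`: biduality identifies `G` with `Hom(L, C)`, and `L` is
`Ext^0(G, C)`. -/
theorem IsTotallyReflexive.isDualizedBy [IsNoetherianRing R] {C Y : ModuleCat.{u} R}
    [Module.Finite R C] {d : ℕ} (hY : ∀ i < d, Subsingleton (Ext Y C i)) {G : ModuleCat.{u} R}
    (hG : IsTotallyReflexive R C G) : IsDualizedBy C Y d 0 G := by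
  have := hG.finite
  let L : ModuleCat.{u} R := ModuleCat.of R (G →ₗ[R] C)
  have : Module.Finite R L := inferInstanceAs (Module.Finite R (G →ₗ[R] C))
  have hL : ∀ i, 0 < i → Subsingleton (Ext L C i) := hG.ext_dual
  let η : G ≅ ModuleCat.of R (L →ₗ[R] C) :=
    (LinearEquiv.ofBijective (LinearMap.applyₗ : G →ₗ[R] (L →ₗ[R] C)) hG.eval_bijective).toModuleIso
  have hη : ∀ l : G ⟶ C, η.hom ≫ evalHom C (L := L) l.hom = l := fun l ↦ rfl
  have hη' : ∀ l : G ⟶ C, η.inv ≫ l = evalHom C (L := L) l.hom := fun l ↦ by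
    rw [Iso.inv_comp_eq, hη]
  have hinv : ∀ {i : ℕ} (e : Ext Y G i), e.comp (Ext.mk₀ η.hom) (add_zero i) = 0 → e = 0 := by
    intro i e he
    rw [← Ext.comp_mk₀_id e, ← η.hom_inv_id, ← Ext.mk₀_comp_mk₀,
      ← Ext.comp_assoc_of_third_deg_zero, he, Ext.zero_comp]
  refine ⟨fun l hl ↦ hG.ext_left l hl, fun i hi ↦ ?_, ?_, ?_⟩
  · have := subsingleton_ext_dual hY (i := i) (by omega) hL
    exact subsingleton_of_forall_eq 0 fun e ↦ hinv e (Subsingleton.elim _ _)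
  · intro i hi e he
    obtain rfl : i = d := hi
    refine hinv e (eq_zero_of_comp_evalHom hY le_rfl hL _ fun l ↦ ?_)
    rw [Ext.comp_assoc_of_third_deg_zero, Ext.mk₀_comp_mk₀]
    exact he (Ext.mk₀ (ModuleCat.ofHom l))
  · intro i hi φ
    obtain rfl : i = d := hi
    let ψ : L →ₗ[R] Ext G C 0 :=
      { toFun := fun l ↦ Ext.mk₀ (ModuleCat.ofHom l)
        map_add' := fun l l' ↦ by rw [← Ext.mk₀_add]; rfl
        map_smul' := fun r l ↦ by rw [RingHom.id_apply, ← Ext.mk₀_smul]; rfl }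
    obtain ⟨e, he⟩ := exists_comp_evalHom hY hL (φ.comp ψ)
    refine ⟨e.comp (Ext.mk₀ η.inv) (add_zero _), fun f ↦ ?_⟩
    obtain ⟨g, rfl⟩ := (Ext.mk₀_bijective _ _).2 f
    rw [Ext.comp_assoc_of_third_deg_zero, Ext.mk₀_comp_mk₀, hη']
    exact he g.hom

variable {C Y : ModuleCat.{u} R} {d j : ℕ}

/-- The codegree need not be sharp: one step up, both sides of the duality are zero. -/
theorem IsDualizedBy.succ {X : ModuleCat.{u} R} (h : IsDualizedBy C Y d j X) :
    IsDualizedBy C Y d (j + 1) X := by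
  have h0 := h.ext_zero (j + 1) (by omega)
  refine ⟨fun l hl ↦ h.ext_zero l (by omega), fun i hi ↦ h.low i (by omega),
    fun i hi e he ↦ ?_, fun i hi φ ↦ ⟨0, fun f ↦ ?_⟩⟩
  · have := h.low i (by omega)
    exact Subsingleton.elim _ _
  · rw [Subsingleton.elim f 0, map_zero, Ext.comp_zero]

theorem IsDualizedBy.of_le {X : ModuleCat.{u} R} {k : ℕ} (h : IsDualizedBy C Y d j X)
    (hjk : j ≤ k) : IsDualizedBy C Y d k X := by
  induction hjk with
  | refl => exact h
  | step _ ih => exact ih.succ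

/-- Connecting maps lead from `Ext^i(Y, X₃)` to `Ext^(i+1)(Y, X₁)` and from `Ext^j(X₁, C)` to
`Ext^(j+1)(X₃, C)`, and associativity of the Yoneda product makes them compatible. This serves both
for resolutions and for division by a regular element. -/
theorem IsDualizedBy.of_shortExact {S : ShortComplex (ModuleCat.{u} R)} (hS : S.ShortExact)
    (h₁ : IsDualizedBy C Y d j S.X₁) (h₂ : IsDualizedBy C Y d j S.X₂) :
    IsDualizedBy C Y d (j + 1) S.X₃ := by
  refine ⟨fun l hl ↦ ?_, fun i hi ↦ ?_, fun i hi e he ↦ ?_, fun i hi φ ↦ ?_⟩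
  · obtain ⟨l, rfl⟩ := Nat.exists_eq_succ_of_ne_zero (by omega : l ≠ 0)
    exact subsingleton_ext_X₃_of_contravariant hS C (h₁.ext_zero l (by omega))
      (h₂.ext_zero _ (by omega))
  · exact subsingleton_ext_X₃_of_covariant hS Y (h₂.low i (by omega)) (h₁.low _ (by omega))
  · have h0 : e.comp hS.extClass rfl = 0 := by
      refine h₁.inj (i + 1) (by omega) _ fun f ↦ ?_
      rw [Ext.comp_assoc e hS.extClass f rfl (add_comm 1 j) (by omega)]
      exact he _
    obtain ⟨e', rfl⟩ := Ext.covariant_sequence_exact₃ Y hS e rfl h0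
    have := h₂.low i (by omega)
    rw [Subsingleton.elim e' 0, Ext.zero_comp]
  · obtain ⟨e', he'⟩ := h₁.surj (i + 1) (by omega)
      (φ.comp (hS.extClass.precompOfLinear R C (add_comm 1 j)))
    have h0 : e'.comp (Ext.mk₀ S.f) (add_zero _) = 0 := by
      refine h₂.inj (i + 1) (by omega) _ fun f ↦ ?_
      rw [Ext.comp_assoc_of_second_deg_zero, he']
      simp [hS.extClass_comp_assoc]
    obtain ⟨e, rfl⟩ := Ext.covariant_sequence_exact₁ Y hS e' h0 rfl
    refine ⟨e, fun f ↦ ?_⟩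
    have := h₂.ext_zero (j + 1) (by omega)
    obtain ⟨f, rfl⟩ := Ext.contravariant_sequence_exact₃ hS C f (Subsingleton.elim _ _)
      (add_comm 1 j)
    rw [← Ext.comp_assoc e hS.extClass f rfl (add_comm 1 j) (by omega), he']
    rfl

end Duality

/-! ### Finite resolutions by totally reflexive modules. -/

section Resolutions

variable {R : Type u} [CommRing R]

/-- `X` has a resolution of length at most `n` by totally `C`-reflexive modules. -/
def HasReflexiveResolution (C : ModuleCat.{u} R) : ℕ → ModuleCat.{u} R → Prop
  | 0, X => IsTotallyReflexive R C X
  | n + 1, X => ∃ (X' G : ModuleCat.{u} R) (f : X' ⟶ G) (g : G ⟶ X) (w : f ≫ g = 0),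
      (ShortComplex.mk f g w).ShortExact ∧ IsTotallyReflexive R C G ∧
      HasReflexiveResolution C n X'

variable {C : ModuleCat.{u} R}

theorem isTotallyReflexive_of_subsingleton (X : ModuleCat.{u} R) [Subsingleton X] :
    IsTotallyReflexive R C X where
  finite := inferInstance
  eval_bijective := ⟨Function.injective_of_subsingleton _, fun φ ↦ ⟨0, by
    ext f; rw [Subsingleton.elim f 0, map_zero, map_zero]⟩⟩
  ext_left i _ := subsingleton_of_forall_eq 0 fun e ↦ by
    have : 𝟙 (ModuleCat.of R X) = 0 := by ext x; exact Subsingleton.elim _ _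
    rw [← Ext.mk₀_id_comp e, this, Ext.mk₀_zero, Ext.zero_comp]
  ext_dual i _ := subsingleton_of_forall_eq 0 fun e ↦ by
    have : 𝟙 (ModuleCat.of R (X →ₗ[R] C)) = 0 := by ext x : 2; exact Subsingleton.elim _ _
    rw [← Ext.mk₀_id_comp e, this, Ext.mk₀_zero, Ext.zero_comp]

theorem HasReflexiveResolution.succ {n : ℕ} {X : ModuleCat.{u} R}
    (h : HasReflexiveResolution C n X) : HasReflexiveResolution C (n + 1) X := by
  induction n generalizing X with
  | zero =>
    refine ⟨ModuleCat.of R PUnit, X, 0, 𝟙 X, by simp, ?_, h,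
      isTotallyReflexive_of_subsingleton _⟩
    refine ModuleCat.shortComplex_shortExact _ (fun x ↦ ⟨fun hx ↦ ⟨0, ?_⟩, ?_⟩)
      (Function.injective_of_subsingleton _) Function.surjective_id
    · rw [map_zero]; exact hx.symm
    · rintro ⟨y, rfl⟩; rfl
  | succ n ih =>
    obtain ⟨X', G, f, g, w, hS, hG, hX'⟩ := h
    exact ⟨X', G, f, g, w, hS, hG, ih hX'⟩

theorem HasReflexiveResolution.of_le {n m : ℕ} (hnm : n ≤ m) {X : ModuleCat.{u} R}
    (h : HasReflexiveResolution C n X) : HasReflexiveResolution C m X := by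
  induction hnm with
  | refl => exact h
  | step _ ih => exact ih.succ

/-- The length `n + 1` lets the zero module `G (n + 1)` start the recursion; the loss is harmless,
since `HasReflexiveResolution.of_depth` later shortens any finite resolution. -/
theorem GCDimLE.hasReflexiveResolution {n : ℕ} {M : Type u} [AddCommGroup M] [Module R M]
    (h : GCDimLE R C M n) : HasReflexiveResolution C (n + 1) (ModuleCat.of R M) := by
  induction n generalizing M with
  | zero =>
    obtain ⟨G, d, ε, hG, h0, hε, hd, -⟩ := h
    have := h0 1 one_pos
    exact ⟨G 1, G 0, ModuleCat.ofHom (d 0), ModuleCat.ofHom ε,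
      ModuleCat.hom_ext hd.linearMap_comp_eq_zero,
      shortExact_of_linearMap (Function.injective_of_subsingleton _) hd hε, hG 0, hG 1⟩
  | succ n ih =>
    obtain ⟨G, d, ε, hG, h0, hε, hd, hdd⟩ := h
    refine ⟨ModuleCat.of R (LinearMap.ker ε), G 0, ModuleCat.ofHom (LinearMap.ker ε).subtype,
      ModuleCat.ofHom ε, ModuleCat.hom_ext (LinearMap.exact_subtype_ker_map ε).linearMap_comp_eq_zero,
      shortExact_of_linearMap (Submodule.subtype_injective _) (LinearMap.exact_subtype_ker_map ε) hε,
      hG 0, ih ⟨fun i ↦ G (i + 1), fun i ↦ d (i + 1),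
        (d 0).codRestrict _ fun x ↦ (hd _).2 ⟨x, rfl⟩, fun i ↦ hG _, fun i hi ↦ h0 _ (by omega),
        ?_, ?_, fun i ↦ hdd _⟩⟩
    · rintro ⟨y, hy⟩
      obtain ⟨x, rfl⟩ := (hd y).1 hy
      exact ⟨x, rfl⟩
    · intro x
      rw [← hdd 0 x]
      exact Subtype.ext_iff

theorem HasReflexiveResolution.isDualizedBy [IsNoetherianRing R] {Y : ModuleCat.{u} R}
    [Module.Finite R C] {d n : ℕ} (hY : ∀ i < d, Subsingleton (Ext Y C i)) {X : ModuleCat.{u} R}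
    (hX : HasReflexiveResolution C n X) : IsDualizedBy C Y d n X := by
  induction n generalizing X with
  | zero => exact IsTotallyReflexive.isDualizedBy hY hX
  | succ n ih =>
    obtain ⟨X', G, f, g, w, hS, hG, hX'⟩ := hX
    exact .of_shortExact hS (ih hX') ((hG.isDualizedBy hY).of_le (Nat.zero_le n))

/-- The cokernel of an injection of totally reflexive modules is totally reflexive if its first
`Ext` group into `C` vanishes. -/
theorem isTotallyReflexive_of_shortExact {S : ShortComplex (ModuleCat.{u} R)} (hS : S.ShortExact)
    (h₁ : IsTotallyReflexive R C S.X₁) (h₂ : IsTotallyReflexive R C S.X₂)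
    (h₃ : Subsingleton (Ext S.X₃ C 1)) : IsTotallyReflexive R C S.X₃ := by
  have hdual := shortExact_dual hS C h₃
  have hd₁ : ∀ i, 0 < i → Subsingleton (Ext (ModuleCat.of R (S.X₁ →ₗ[R] C)) C i) := h₁.ext_dual
  have hd₂ : ∀ i, 0 < i → Subsingleton (Ext (ModuleCat.of R (S.X₂ →ₗ[R] C)) C i) := h₂.ext_dual
  refine ⟨?_, ⟨?_, ?_⟩, fun i hi ↦ ?_, fun i hi ↦ ?_⟩
  · have := h₂.finite
    exact Module.Finite.of_surjective S.g.hom hS.moduleCat_surjective_g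
  · rw [injective_iff_map_eq_zero]
    intro x hx
    obtain ⟨y, rfl⟩ := hS.moduleCat_surjective_g x
    -- If all functionals kill `S.g y`, evaluation at `y` factors through the dual of `S.X₁`;
    -- reflexivity turns the factor into evaluation at some `z`, whence `y = S.f z`.
    obtain ⟨ψ, hψ⟩ := exists_factor_of_apply_eq_zero hdual C
      (LinearMap.applyₗ y : (S.X₂ →ₗ[R] C) →ₗ[R] C) fun φ ↦ congr($hx φ)
    obtain ⟨z, hz⟩ := h₁.eval_bijective.2 ψ
    have : S.f z = y := by
      apply h₂.eval_bijective.1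
      ext φ
      rw [← hψ, ← hz]
      rfl
    rw [← this]
    exact S.moduleCat_zero_apply z
  · intro ξ
    obtain ⟨ψ, hψ⟩ := exists_extension_of_subsingleton_ext_one hdual C (hd₁ 1 one_pos) ξ
    obtain ⟨y, rfl⟩ := h₂.eval_bijective.2 ψ
    exact ⟨S.g y, LinearMap.ext hψ⟩
  · obtain rfl | hi' := (show 1 ≤ i from hi).eq_or_lt
    · exact h₃
    · obtain ⟨i, rfl⟩ := Nat.exists_eq_succ_of_ne_zero hi.ne'
      exact subsingleton_ext_X₃_of_contravariant hS C (h₁.ext_left i (by omega)) (h₂.ext_left _ hi)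
  · exact subsingleton_ext_X₁_of_contravariant hdual C (hd₂ i hi) (hd₁ _ (by omega))

end Resolutions

/-! ### Bounding the length of a resolution by depth, after Auslander and Bridger. -/

section AuslanderBridger

variable {R : Type u} [CommRing R]

theorem exists_surjective_to_residueField [IsLocalRing R] (N : Type u) [AddCommGroup N] [Module R N]
    [Module.Finite R N] [Nontrivial N] : ∃ f : N →ₗ[R] ResidueField R, Function.Surjective f := by
  obtain ⟨P, hP, -⟩ := (eq_top_or_exists_le_coatom (⊥ : Submodule R N)).resolve_left bot_ne_top
  obtain ⟨I, hI, ⟨e⟩⟩ := isSimpleModule_iff_quot_maximal.1 (isSimpleModule_iff_isCoatom.2 hP)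
  obtain rfl := eq_maximalIdeal hI
  exact ⟨e.toLinearMap.comp P.mkQ, e.surjective.comp P.mkQ_surjective⟩

theorem exists_residueField_map [IsLocalRing R] {E : Type u} [AddCommGroup E] [Module R E] (v : E)
    (hv : ∀ a ∈ maximalIdeal R, a • v = 0) :
    ∃ φ : ResidueField R →ₗ[R] E, φ 1 = v := by
  refine ⟨Submodule.liftQ (maximalIdeal R) (LinearMap.toSpanSingleton R E v) fun a ha ↦ ?_, ?_⟩
  · simpa using hv a ha
  · exact (Submodule.liftQ_apply _ _ (1 : R)).trans (one_smul R v)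

variable [IsNoetherianRing R] [IsLocalRing R] {C : ModuleCat.{u} R} [Module.Finite R C] {d : ℕ}
  (hlt : ∀ i < d, Subsingleton (Ext (ModuleCat.of R (ResidueField R)) C i))
  (hd : Nontrivial (Ext (ModuleCat.of R (ResidueField R)) C d))
include hlt hd

/-- Otherwise there is a nonzero map `Ext^1(X₃, C) → k → Ext^d(k, C)`. Precomposed with the
surjection from `Ext^0(X₁, C)`, it is given by duality by a class in `Ext^d(k, X₁)`. That class dies
in `Ext^d(k, X₂)`, so it comes from `Ext^(d-1)(k, X₃) = 0` (for `d = 0`, by injectivity of `S.f`), a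
contradiction. -/
theorem subsingleton_ext_one_of_depth {S : ShortComplex (ModuleCat.{u} R)} (hS : S.ShortExact)
    (h₁ : IsTotallyReflexive R C S.X₁) (h₂ : IsTotallyReflexive R C S.X₂)
    (hX : ∀ i < d, Subsingleton (Ext (ModuleCat.of R (ResidueField R)) S.X₃ i)) :
    Subsingleton (Ext S.X₃ C 1) := by
  by_contra hne
  rw [not_subsingleton_iff_nontrivial] at hne
  have := h₂.finite
  have : Module.Finite R S.X₃ := Module.Finite.of_surjective S.g.hom hS.moduleCat_surjective_g
  obtain ⟨q, hq⟩ := exists_surjective_to_residueField (R := R) (Ext S.X₃ C 1)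
  obtain ⟨v, hv⟩ := exists_ne (0 : Ext (ModuleCat.of R (ResidueField R)) C d)
  obtain ⟨ψ, hψ⟩ := exists_residueField_map v fun a ha ↦
    @isTorsionBySet_ext R _ _ C _ _ d v ⟨a, ha⟩
  have := h₂.ext_left 1 one_pos
  obtain ⟨e, he⟩ := (h₁.isDualizedBy hlt).surj d rfl
    ((ψ.comp q).comp (hS.extClass.precompOfLinear R C (add_zero 1)))
  have h0 : e.comp (Ext.mk₀ S.f) (add_zero _) = 0 := by
    refine (h₂.isDualizedBy hlt).inj d rfl _ fun f ↦ ?_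
    rw [Ext.comp_assoc_of_second_deg_zero, he]
    simp [hS.extClass_comp_assoc]
  have he0 : e = 0 := by
    cases d with
    | zero =>
      have := hS.mono_f
      exact Ext.postcomp_mk₀_injective_of_mono _ S.f (by simpa using h0)
    | succ d =>
      obtain ⟨e', rfl⟩ := Ext.covariant_sequence_exact₁ _ hS e h0 rfl
      have := hX d (by omega)
      rw [Subsingleton.elim e' 0, Ext.zero_comp]
  obtain ⟨w, hw⟩ := hq 1
  obtain ⟨f, rfl⟩ := Ext.contravariant_sequence_exact₃ hS C w (Subsingleton.elim _ _) (add_zero 1)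
  have h1 := he f
  rw [he0, Ext.zero_comp] at h1
  refine hv (h1.trans ?_).symm
  change ψ (q (hS.extClass.comp f (add_zero 1))) = v
  rw [hw, hψ]

/-- A module with a finite resolution by totally reflexive modules has one of length at most
`d - depth`, where `d` is the depth of `C`. -/
theorem HasReflexiveResolution.of_depth {n j : ℕ} {X : ModuleCat.{u} R}
    (hX : HasReflexiveResolution C n X)
    (hdepth : ∀ i, i + j < d → Subsingleton (Ext (ModuleCat.of R (ResidueField R)) X i)) :
    HasReflexiveResolution C j X := by
  induction n generalizing j X with
  | zero => exact hX.of_le (Nat.zero_le j)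
  | succ n ih =>
    obtain ⟨X', G, f, g, w, hS, hG, hX'⟩ := hX
    have hG' := (hG.isDualizedBy hlt).low
    cases j with
    | zero =>
      -- `X` and `G` have no `Ext` from `k` below degree `d`, hence neither has `X'`, which is
      -- totally reflexive by induction.
      refine isTotallyReflexive_of_shortExact hS (ih (j := 0) hX' fun i hi ↦ ?_) hG ?_
      · cases i with
        | zero => exact subsingleton_ext_zero_X₁ hS _ (hG' _ hi)
        | succ i => exact subsingleton_ext_X₁_of_covariant hS _ (hdepth i (by omega)) (hG' _ hi)
      · refine subsingleton_ext_one_of_depth hlt hd hS (ih (j := 0) hX' fun i hi ↦ ?_) hG hdepth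
        cases i with
        | zero => exact subsingleton_ext_zero_X₁ hS _ (hG' _ hi)
        | succ i => exact subsingleton_ext_X₁_of_covariant hS _ (hdepth i (by omega)) (hG' _ hi)
    | succ j =>
      refine ⟨X', G, f, g, w, hS, hG, ih hX' fun i hi ↦ ?_⟩
      cases i with
      | zero => exact subsingleton_ext_zero_X₁ hS _ (hG' _ (by omega))
      | succ i =>
        exact subsingleton_ext_X₁_of_covariant hS _ (hdepth i (by omega)) (hG' _ (by omega))

end AuslanderBridger

end LocalAlg

end

noncomputable section

namespace LocalAlg

open CategoryTheory CategoryTheory.Abelian IsLocalRing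

/-! ### Length estimates for `Ext(X, C)` with `X` of finite length. -/

section FiniteLength

variable {R : Type u} [CommRing R]

/-- Keeping the range of `g` instead of all of `D` is what later turns a length count into
surjectivity. -/
theorem length_le_add_of_exact {A B D : Type*} [AddCommGroup A] [Module R A] [AddCommGroup B]
    [Module R B] [AddCommGroup D] [Module R D] {f : A →ₗ[R] B} {g : B →ₗ[R] D}
    (h : Function.Exact f g) :
    Module.length R B ≤ Module.length R A + Module.length R (LinearMap.range g) := by
  rw [Module.length_eq_add_of_exact (LinearMap.ker g).subtype g.rangeRestrict
    (Submodule.subtype_injective _) g.surjective_rangeRestrict (fun x ↦ by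
      rw [← LinearMap.exact_subtype_ker_map g x, Subtype.ext_iff]; rfl)]
  gcongr
  exact Module.length_le_of_surjective (f.codRestrict (LinearMap.ker g) fun x ↦ (h _).2 ⟨x, rfl⟩)
    fun ⟨y, hy⟩ ↦ let ⟨x, hx⟩ := (h y).1 hy; ⟨x, Subtype.ext hx⟩

theorem length_range_le {A B : Type*} [AddCommGroup A] [Module R A] [AddCommGroup B]
    [Module R B] (f : A →ₗ[R] B) : Module.length R (LinearMap.range f) ≤ Module.length R B :=
  Module.length_le_of_injective _ (Submodule.subtype_injective _)

theorem finite_of_length_ne_top {X : Type*} [AddCommGroup X] [Module R X]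
    (h : Module.length R X ≠ ⊤) : Module.Finite R X := by
  have := (isFiniteLength_iff_isNoetherian_isArtinian.1 (Module.length_ne_top_iff.1 h)).1
  infer_instance

theorem length_fun_ne_top {X : Type*} [AddCommGroup X] [Module R X] {n : ℕ}
    (h : Module.length R X ≠ ⊤) : Module.length R (Fin n → X) ≠ ⊤ := by
  rw [Module.length_pi_of_fintype, Finset.sum_const, nsmul_eq_mul]
  exact WithTop.mul_ne_top (ENat.natCast_ne_top _) h

theorem subsingleton_ext_of_subsingleton {X : ModuleCat.{u} R} [Subsingleton X] {C : ModuleCat.{u} R}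
    {i : ℕ} : Subsingleton (Ext X C i) := by
  refine subsingleton_of_forall_eq 0 fun e ↦ ?_
  have : 𝟙 X = 0 := by ext x; exact Subsingleton.elim _ _
  rw [← Ext.mk₀_id_comp e, this, Ext.mk₀_zero, Ext.zero_comp]

theorem precomp_exact {C : ModuleCat.{u} R} {S : ShortComplex (ModuleCat.{u} R)} (hS : S.ShortExact) (i : ℕ) :
    Function.Exact ((Ext.mk₀ S.g).precompOfLinear R C (zero_add i))
      ((Ext.mk₀ S.f).precompOfLinear R C (zero_add i)) := by
  intro x
  refine ⟨fun hx ↦ Ext.contravariant_sequence_exact₂ hS C x hx, ?_⟩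
  rintro ⟨y, rfl⟩
  simp

variable [IsLocalRing R]

theorem length_residueField : Module.length R (ResidueField R) = 1 :=
  Module.length_eq_one_iff.2
    (isSimpleModule_iff_quot_maximal.2 ⟨maximalIdeal R, inferInstance, ⟨.refl R _⟩⟩)

theorem exists_shortExact_residueField (X : ModuleCat.{u} R) [Module.Finite R X] [Nontrivial X] :
    ∃ (V : ModuleCat.{u} R) (f : V ⟶ X) (g : X ⟶ ModuleCat.of R (ResidueField R)) (w : f ≫ g = 0),
      (ShortComplex.mk f g w).ShortExact ∧ Module.length R X = Module.length R V + 1 := by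
  obtain ⟨p, hp⟩ := exists_surjective_to_residueField (R := R) X
  exact ⟨_, _, _, _, LinearMap.shortExact_shortComplexKer hp,
    length_residueField (R := R) ▸ Module.length_eq_add_of_exact (LinearMap.ker p).subtype p
      (Submodule.subtype_injective _) hp (LinearMap.exact_subtype_ker_map p)⟩

theorem finiteLength_induction {P : ModuleCat.{u} R → Prop} (zero : ∀ X : ModuleCat.{u} R, Subsingleton X → P X)
    (step : ∀ (V X : ModuleCat.{u} R) (f : V ⟶ X) (g : X ⟶ ModuleCat.of R (ResidueField R))
      (w : f ≫ g = 0), (ShortComplex.mk f g w).ShortExact →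
      Module.length R X = Module.length R V + 1 → P V → P X)
    (X : ModuleCat.{u} R) (hX : Module.length R X ≠ ⊤) : P X := by
  obtain ⟨n, hn⟩ := ENat.ne_top_iff_exists.1 hX
  induction n generalizing X with
  | zero => exact zero X (Module.length_eq_zero_iff.1 hn.symm)
  | succ n ih =>
    have := finite_of_length_ne_top hX
    have : Nontrivial X := (Module.length_pos_iff (R := R)).1 (by rw [← hn]; simp)
    obtain ⟨V, f, g, w, hS, hl⟩ := exists_shortExact_residueField X
    have hV : (n : ℕ∞) = Module.length R V := by
      rw [← hn, Nat.cast_succ] at hl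
      exact WithTop.add_right_cancel ENat.one_ne_top hl
    exact step V X f g w hS hl (ih V (hV ▸ ENat.natCast_ne_top n) hV)

variable {C : ModuleCat.{u} R}

theorem subsingleton_ext_of_length {i : ℕ}
    (h : Subsingleton (Ext (ModuleCat.of R (ResidueField R)) C i)) (X : ModuleCat.{u} R)
    (hX : Module.length R X ≠ ⊤) : Subsingleton (Ext X C i) :=
  finiteLength_induction (P := fun X ↦ Subsingleton (Ext X C i))
    (fun _ _ ↦ subsingleton_ext_of_subsingleton)
    (fun _ _ _ _ _ hS _ hV ↦ subsingleton_ext_X₂_of_contravariant hS C hV h) X hX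

theorem length_ext_le {i : ℕ}
    (h : Module.length R (Ext (ModuleCat.of R (ResidueField R)) C i) ≤ 1) (X : ModuleCat.{u} R)
    (hX : Module.length R X ≠ ⊤) : Module.length R (Ext X C i) ≤ Module.length R X := by
  refine finiteLength_induction (P := fun X ↦ Module.length R (Ext X C i) ≤ Module.length R X)
    (fun X _ ↦ ?_) (fun V X f g w hS hl hV ↦ ?_) X hX
  · have := subsingleton_ext_of_subsingleton (X := X) (C := C) (i := i)
    rw [Module.length_eq_zero]
    exact zero_le
  · rw [hl, add_comm]
    exact (length_le_add_of_exact (precomp_exact hS i)).trans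
      (add_le_add h ((length_range_le _).trans hV))

theorem length_linearMap_le {W : Type u} [AddCommGroup W] [Module R W]
    (h : Module.length R (ResidueField R →ₗ[R] W) ≤ 1) (X : ModuleCat.{u} R)
    (hX : Module.length R X ≠ ⊤) : Module.length R (X →ₗ[R] W) ≤ Module.length R X := by
  refine finiteLength_induction (P := fun X ↦ Module.length R (X →ₗ[R] W) ≤ Module.length R X)
    (fun X _ ↦ ?_) (fun V X f g w hS hl hV ↦ ?_) X hX
  · rw [Module.length_eq_zero]
    exact zero_le
  · rw [hl, add_comm]
    refine (length_le_add_of_exact (f := LinearMap.lcomp R W g.hom) (g := LinearMap.lcomp R W f.hom)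
      fun φ ↦ ⟨fun hφ ↦ ?_, ?_⟩).trans (add_le_add h ((length_range_le _).trans hV))
    · obtain ⟨ψ, hψ⟩ := exists_factor_of_apply_eq_zero hS (ModuleCat.of R W) φ
        fun x ↦ congr($hφ x)
      exact ⟨ψ, LinearMap.ext hψ⟩
    · rintro ⟨ψ, rfl⟩
      ext x
      have : g (f x) = 0 := congr($w x)
      simp [this]

variable {d : ℕ}
  (hlt : ∀ i < d, Subsingleton (Ext (ModuleCat.of R (ResidueField R)) C i))

include hlt in
-- The kernel is an image of `Ext^(d-1)(X₁, C)`, which vanishes by dévissage to `k`.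
theorem precomp_injective_of_length {S : ShortComplex (ModuleCat.{u} R)} (hS : S.ShortExact)
    (h₁ : Module.length R S.X₁ ≠ ⊤) (e : Ext S.X₃ C d)
    (he : (Ext.mk₀ S.g).comp e (zero_add d) = 0) : e = 0 := by
  cases d with
  | zero =>
    have := hS.epi_g
    exact Ext.precomp_mk₀_injective_of_epi _ S.g (by simpa using he)
  | succ d =>
    obtain ⟨e', rfl⟩ := Ext.contravariant_sequence_exact₃ hS C e he (add_comm 1 d)
    have := subsingleton_ext_of_length (hlt d (by omega)) _ h₁
    rw [Subsingleton.elim e' 0, Ext.comp_zero]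

include hlt in
/-- The socle of `Ext^d(R/I, C)` comes from `Ext^d(k, C)`. -/
theorem exists_precomp_of_smul_eq_zero [IsNoetherianRing R] {I : Ideal R} (hI : I ≤ maximalIdeal R)
    (hl : Module.length R (R ⧸ I) ≠ ⊤) (w : Ext (ModuleCat.of R (R ⧸ I)) C d)
    (hw : ∀ a ∈ maximalIdeal R, a • w = 0) :
    ∃ v : Ext (ModuleCat.of R (ResidueField R)) C d,
      (Ext.mk₀ (ModuleCat.ofHom (Submodule.factor hI))).comp v (zero_add d) = w := by
  obtain ⟨n, x, hx⟩ := Submodule.fg_iff_exists_fin_generating_family.1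
    (IsNoetherian.noetherian (maximalIdeal R))
  let p : (R ⧸ I) →ₗ[R] ResidueField R := Submodule.factor hI
  have hp : Function.Surjective p := Submodule.factor_surjective hI
  have hS := LinearMap.shortExact_shortComplexKer hp
  refine Ext.contravariant_sequence_exact₂ hS C w ?_
  have hpx : ∀ a : R ⧸ I, ∀ j, p (x j • a) = 0 := by
    intro a j
    rw [map_smul]
    obtain ⟨b, hb⟩ := residue_surjective (p a)
    rw [← hb, Algebra.smul_def, ResidueField.algebraMap_eq,
      (residue_eq_zero_iff (x j)).2 (hx ▸ Submodule.subset_span ⟨j, rfl⟩), zero_mul]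
  -- The obstruction is the restriction of `w` to `𝔪/I`. Generators of `𝔪` give a surjection from
  -- `(R/I)^n` onto `𝔪/I`, along which pullback is injective in degree `d`; the pullback is a sum of
  -- multiples `x j • w` composed with projections, hence zero.
  let Ψ : (Fin n → R ⧸ I) →ₗ[R] LinearMap.ker p :=
    (∑ j, x j • LinearMap.proj j).codRestrict _ fun a ↦ by
      simp only [LinearMap.sum_apply, LinearMap.smul_apply, LinearMap.mem_ker, map_sum]
      exact Finset.sum_eq_zero fun j _ ↦ hpx _ j
  have hΨ : Function.Surjective Ψ := by
    rintro ⟨y, hy⟩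
    obtain ⟨r, rfl⟩ := Submodule.Quotient.mk_surjective _ y
    have hr : r ∈ maximalIdeal R := (Submodule.Quotient.mk_eq_zero _).1 hy
    rw [← hx] at hr
    obtain ⟨c, rfl⟩ := (Submodule.mem_span_range_iff_exists_fun R).1 hr
    refine ⟨fun j ↦ Submodule.Quotient.mk (c j), Subtype.ext ?_⟩
    simp only [Ψ, LinearMap.codRestrict_apply, LinearMap.sum_apply, LinearMap.smul_apply,
      LinearMap.proj_apply]
    rw [← Submodule.mkQ_apply, map_sum]
    refine Finset.sum_congr rfl fun j _ ↦ ?_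
    rw [← Submodule.mkQ_apply, ← map_smul, smul_eq_mul, smul_eq_mul, mul_comm]
  refine precomp_injective_of_length hlt (LinearMap.shortExact_shortComplexKer hΨ) ?_ _ ?_
  · refine ne_top_of_le_ne_top ?_ (Module.length_le_of_injective (LinearMap.ker Ψ).subtype
      (Submodule.subtype_injective _))
    exact length_fun_ne_top hl
  · have key : (ModuleCat.ofHom Ψ ≫ ModuleCat.ofHom (LinearMap.ker p).subtype) =
        ∑ j, x j • ModuleCat.ofHom (LinearMap.proj (R := R) (φ := fun _ : Fin n ↦ R ⧸ I) j) := by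
      ext a
      simp [Ψ, ModuleCat.hom_sum]
    refine (Ext.mk₀_comp_mk₀_assoc _ _ w).trans ?_
    refine (congrArg (fun t ↦ (Ext.mk₀ t).comp w (zero_add d)) key).trans ?_
    rw [Ext.mk₀_sum, Ext.sum_comp]
    refine Finset.sum_eq_zero fun j _ ↦ ?_
    rw [Ext.mk₀_smul, Ext.smul_comp, ← Ext.comp_smul, hw _ (hx ▸ Submodule.subset_span ⟨j, rfl⟩),
      Ext.comp_zero]

variable (htype : Module.length R (Ext (ModuleCat.of R (ResidueField R)) C d) ≤ 1)
include htype

include hlt in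
-- A map out of `k` is its value at `1`, a socle element, and the socle lies in the image of
-- `Ext^d(k, C)`.
theorem length_residueField_linearMap_ext_le [IsNoetherianRing R] {I : Ideal R} (hI : I ≤ maximalIdeal R)
    (hl : Module.length R (R ⧸ I) ≠ ⊤) :
    Module.length R (ResidueField R →ₗ[R] Ext (ModuleCat.of R (R ⧸ I)) C d) ≤ 1 := by
  let α := (Ext.mk₀ (ModuleCat.ofHom (Submodule.factor hI))).precompOfLinear R C (zero_add d)
  have hsmul : ∀ a ∈ maximalIdeal R, a • (1 : ResidueField R) = 0 := fun a ha ↦ by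
    rw [Algebra.smul_def, ResidueField.algebraMap_eq, (residue_eq_zero_iff a).2 ha, zero_mul]
  let θ : (ResidueField R →ₗ[R] Ext (ModuleCat.of R (R ⧸ I)) C d) →ₗ[R] LinearMap.range α :=
    (LinearMap.applyₗ (1 : ResidueField R)).codRestrict _ fun φ ↦
      exists_precomp_of_smul_eq_zero hlt hI hl _ fun a ha ↦ by
        rw [LinearMap.applyₗ_apply_apply, ← map_smul, hsmul a ha, map_zero]
  refine (Module.length_le_of_injective θ fun φ ψ h ↦ ?_).trans
    ((Module.length_le_of_surjective _ α.surjective_rangeRestrict).trans htype)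
  have h1 : φ 1 = ψ 1 := congr(($h).1)
  ext y
  obtain ⟨b, rfl⟩ := residue_surjective y
  have : residue R b = b • (1 : ResidueField R) := by
    rw [Algebra.smul_def, ResidueField.algebraMap_eq, mul_one]
  rw [this, map_smul, map_smul, h1]

include hlt in
-- With `I = ann X`, duality for `Y = R/I` embeds `X ≅ Hom(R/I, X)` in `Hom(Ext^d(X, C), Ext^d(R/I,
-- C))`. The target has a socle of length at most one, so this Hom is no longer than `Ext^d(X, C)`.
theorem IsDualizedBy.length_le_length_ext [IsNoetherianRing R] {X : ModuleCat.{u} R}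
    [Nontrivial X]
    (hX : Module.length R X ≠ ⊤)
    (h : ∀ Y : ModuleCat.{u} R, Module.length R Y ≠ ⊤ → IsDualizedBy C Y d d X) :
    Module.length R X ≤ Module.length R (Ext X C d) := by
  have := finite_of_length_ne_top hX
  let I := Module.annihilator R X
  have hI : I ≤ maximalIdeal R := le_maximalIdeal fun h ↦
    not_subsingleton X (Module.annihilator_eq_top_iff.1 h)
  -- Sending `r` to its multiples of finitely many generators of `X` embeds `R/I` in a power of `X`.
  have hlen : Module.length R (R ⧸ I) ≠ ⊤ := by
    obtain ⟨n, x, hx⟩ := Submodule.fg_iff_exists_fin_generating_family.1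
      (Module.Finite.fg_top (R := R) (M := X))
    let θ : R →ₗ[R] (Fin n → X) := LinearMap.pi fun j ↦ LinearMap.toSpanSingleton R X (x j)
    have hθ : LinearMap.ker θ = I := by
      ext r
      simp only [θ, LinearMap.mem_ker, I, Module.mem_annihilator]
      refine ⟨fun hr m ↦ ?_, fun hr ↦ by ext j; exact hr _⟩
      have hm : m ∈ Submodule.span R (Set.range x) := hx ▸ Submodule.mem_top
      induction hm using Submodule.span_induction with
      | mem m hm => obtain ⟨j, rfl⟩ := hm; exact congr($hr j)
      | zero => exact smul_zero _
      | add a b _ _ ha hb => rw [smul_add, ha, hb, add_zero]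
      | smul c a _ ha => rw [smul_comm, ha, smul_zero]
    refine ne_top_of_le_ne_top ?_ (Module.length_le_of_injective (I.liftQ θ hθ.ge) ?_)
    · exact length_fun_ne_top hX
    · rw [← LinearMap.ker_eq_bot, Submodule.ker_liftQ, hθ, Submodule.mkQ_map_self]
  have hN : Module.length R (Ext X C d) ≠ ⊤ :=
    ne_top_of_le_ne_top hX (length_ext_le htype X hX)
  have h1 : Module.length R X ≤ Module.length R ((R ⧸ I) →ₗ[R] X) := by
    refine Module.length_le_of_surjective (LinearMap.applyₗ (Submodule.Quotient.mk 1 : R ⧸ I))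
      fun m ↦ ⟨Submodule.liftQ I (LinearMap.toSpanSingleton R X m) fun a ha ↦
        Module.mem_annihilator.1 ha m, ?_⟩
    change (LinearMap.toSpanSingleton R X m) 1 = m
    simp
  have h2 : Module.length R ((R ⧸ I) →ₗ[R] X) =
      Module.length R (Ext (ModuleCat.of R (R ⧸ I)) X 0) :=
    ((Ext.linearEquiv₀ (R := R) (X := ModuleCat.of R (R ⧸ I)) (Y := X)).trans
      ModuleCat.homLinearEquiv).length_eq.symm
  have h3 : Module.length R (Ext (ModuleCat.of R (R ⧸ I)) X 0) ≤
      Module.length R (Ext X C d →ₗ[R] Ext (ModuleCat.of R (R ⧸ I)) C d) := by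
    refine Module.length_le_of_injective
      (Ext.bilinearCompOfLinear R (ModuleCat.of R (R ⧸ I)) X C 0 d d (zero_add d)) ?_
    rw [injective_iff_map_eq_zero]
    exact fun e he ↦ (h _ hlen).inj 0 (zero_add d) e fun f ↦ congr($he f)
  calc _ ≤ _ := h1
    _ = _ := h2
    _ ≤ _ := h3
    _ ≤ _ := length_linearMap_le (length_residueField_linearMap_ext_le hlt htype hI hlen)
      (ModuleCat.of R (Ext X C d)) hN

/-- In the sequence `0 → V → X → k → 0`, counting lengths makes `Ext^d(X, C) → Ext^d(V, C)`
surjective, so `Ext^(d+1)(k, C)` embeds in `Ext^(d+1)(X, C) = 0`. In higher degrees vanishing for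
`k` passes to `V` by dévissage and then to `k` one degree up. -/
theorem subsingleton_ext_residueField_of_length {X : ModuleCat.{u} R} [Nontrivial X]
    (hX : Module.length R X ≠ ⊤) (hgt : ∀ i, d < i → Subsingleton (Ext X C i))
    (hle : Module.length R X ≤ Module.length R (Ext X C d)) {i : ℕ} (hi : d < i) :
    Subsingleton (Ext (ModuleCat.of R (ResidueField R)) C i) := by
  have := finite_of_length_ne_top hX
  obtain ⟨V, f, g, w, hS, hl⟩ := exists_shortExact_residueField X
  have hV : Module.length R V ≠ ⊤ := ne_top_of_le_ne_top hX (hl ▸ le_self_add)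
  have hTV := length_ext_le htype V hV
  induction hi with
  | refl =>
    let β := (Ext.mk₀ f).precompOfLinear R C (zero_add d)
    have h1 := hle.trans (length_le_add_of_exact (precomp_exact (C := C) hS d))
    have h2 : Module.length R V ≤ Module.length R (LinearMap.range β) := by
      rw [hl, add_comm] at h1
      exact (WithTop.add_le_add_iff_left ENat.one_ne_top).1 (h1.trans (add_le_add_left htype _))
    obtain ⟨_, _⟩ := isFiniteLength_iff_isNoetherian_isArtinian.1
      (Module.length_ne_top_iff.1 (ne_top_of_le_ne_top hV hTV))
    have h3 : LinearMap.range β = ⊤ := by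
      by_contra hne
      exact (Submodule.length_lt hne).not_ge (hTV.trans h2)
    have := hgt (d + 1) (by omega)
    refine subsingleton_of_forall_eq 0 fun e ↦ ?_
    obtain ⟨e', rfl⟩ := Ext.contravariant_sequence_exact₃ hS C e (Subsingleton.elim _ _)
      (add_comm 1 d)
    obtain ⟨y, rfl⟩ := LinearMap.range_eq_top.1 h3 e'
    exact hS.extClass_comp_assoc y
  | @step i hi ih =>
    exact subsingleton_ext_X₃_of_contravariant hS C (subsingleton_ext_of_length ih V hV)
      (hgt _ (Nat.lt_succ_of_lt hi))

end FiniteLength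

end LocalAlg

end

noncomputable section

namespace LocalAlg

open CategoryTheory CategoryTheory.Abelian IsLocalRing

/-! ### Nonvanishing of `Ext^n(k, C)` for `n = dim R`, climbing a saturated chain of primes. -/

section Bass

open scoped Pointwise

variable {R : Type u} [CommRing R]

theorem support_subset_union_of_exact {A B D : Type*} [AddCommGroup A] [Module R A]
    [AddCommGroup B] [Module R B] [AddCommGroup D] [Module R D] {f : A →ₗ[R] B} {g : B →ₗ[R] D}
    (h : Function.Exact f g) :
    Module.support R B ⊆ Module.support R A ∪ Module.support R D := by
  rw [Module.support_of_exact (f := (LinearMap.ker g).subtype) (g := g.rangeRestrict) (fun x ↦ by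
    rw [← LinearMap.exact_subtype_ker_map g x, Subtype.ext_iff]; rfl)
    (Submodule.subtype_injective _) g.surjective_rangeRestrict]
  exact Set.union_subset_union
    (Module.support_subset_of_surjective
      (f.codRestrict (LinearMap.ker g) fun x ↦ (h _).2 ⟨x, rfl⟩)
      fun ⟨y, hy⟩ ↦ let ⟨x, hx⟩ := (h y).1 hy; ⟨x, Subtype.ext hx⟩)
    (Module.support_subset_of_injective _ (Submodule.subtype_injective _))

variable {C : ModuleCat.{u} R}

theorem smul_ext_eq_zero {X : ModuleCat.{u} R} {a : R} (ha : ∀ x : X, a • x = 0) {i : ℕ}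
    (e : Ext X C i) : a • e = 0 := by
  have h0 : a • 𝟙 X = 0 := by ext x; exact ha x
  rw [← Ext.mk₀_id_comp e, ← Ext.smul_comp, ← Ext.mk₀_smul, h0, Ext.mk₀_zero, Ext.zero_comp]

theorem smul_id_comp_ext {A : ModuleCat.{u} R} (x : R) {i : ℕ} (e : Ext A C i) :
    (Ext.mk₀ (x • 𝟙 A)).comp e (zero_add i) = x • e := by
  rw [Ext.mk₀_smul, Ext.smul_comp, Ext.mk₀_id_comp]

/-- Dévissage along a prime filtration of `X`; `p ≤ q` because `p` kills `Ext^i(R/p, C)`. -/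
theorem exists_prime_mem_support_ext [IsNoetherianRing R] {q : PrimeSpectrum R} {i : ℕ} (X : Type u) [AddCommGroup X]
    [Module R X] [hX : Module.Finite R X]
    (hq : q ∈ Module.support R (Ext (ModuleCat.of R X) C i)) :
    ∃ p ∈ Module.support R X, p ≤ q ∧
      q ∈ Module.support R (Ext (ModuleCat.of R (R ⧸ p.asIdeal)) C i) := by
  induction hX using IsNoetherianRing.induction_on_isQuotientEquivQuotientPrime R with
  | subsingleton N =>
    have : Subsingleton (Ext (ModuleCat.of R N) C i) := by
      have : Subsingleton (ModuleCat.of R N) := ‹_›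
      exact subsingleton_ext_of_subsingleton
    rw [Module.support_eq_empty] at hq
    exact hq.elim
  | quotient N p f =>
    let E : ModuleCat.of R N ≅ ModuleCat.of R (R ⧸ p.asIdeal) := f.toModuleIso
    have hinj : Function.Injective ((Ext.mk₀ E.inv).precompOfLinear R C (zero_add i)) := by
      rw [injective_iff_map_eq_zero]
      intro e (he : (Ext.mk₀ E.inv).comp e (zero_add i) = 0)
      rw [← Ext.mk₀_id_comp e, ← E.hom_inv_id, ← Ext.mk₀_comp_mk₀_assoc, he, Ext.comp_zero]
    have hq' := Module.support_subset_of_injective _ hinj hq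
    refine ⟨p, ?_, fun a ha ↦ ?_, hq'⟩
    · rw [f.support_eq, Module.mem_support_iff_of_finite, Ideal.annihilator_quotient]
    · refine Module.annihilator_le_of_mem_support hq' (Module.mem_annihilator.2 fun e ↦ ?_)
      refine smul_ext_eq_zero (fun x ↦ ?_) e
      obtain ⟨r, rfl⟩ := Ideal.Quotient.mk_surjective x
      exact Ideal.Quotient.eq_zero_iff_mem.2 (p.asIdeal.mul_mem_right r ha)
  | exact N₁ N₂ N₃ f g hf hg hfg h₁ h₃ =>
    rw [Module.support_of_exact hfg hf hg]
    rcases support_subset_union_of_exact (precomp_exact (shortExact_of_linearMap hf hfg hg) i) hq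
      with hq | hq
    · obtain ⟨p, hp, h⟩ := h₃ hq
      exact ⟨p, .inr hp, h⟩
    · obtain ⟨p, hp, h⟩ := h₁ hq
      exact ⟨p, .inl hp, h⟩

variable [IsNoetherianRing R] [Module.Finite R C]

/-- For `x ∈ q \ p`, which is regular on `A = R/p`, the quotient of `Ext^i(A, C)` by `x` embeds in
`Ext^(i+1)(A/xA, C)`, and by Nakayama it is still supported at `q`. A prime `r ≤ q` supplied by a
filtration of `A/xA` contains `p` and `x`, so `r = q` as nothing lies strictly between. -/
theorem mem_support_ext_succ_of_covBy {p q : PrimeSpectrum R} (hpq : p ⋖ q) {i : ℕ}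
    (hp : p ∈ Module.support R (Ext (ModuleCat.of R (R ⧸ p.asIdeal)) C i)) :
    q ∈ Module.support R (Ext (ModuleCat.of R (R ⧸ q.asIdeal)) C (i + 1)) := by
  obtain ⟨x, hxq, hxp⟩ := Set.exists_of_ssubset (show (p.asIdeal : Set R) ⊂ q.asIdeal from hpq.1)
  let A := ModuleCat.of R (R ⧸ p.asIdeal)
  have hx : IsSMulRegular A x := by
    refine isSMulRegular_iff_right_eq_zero_of_smul.2 fun y hy ↦ ?_
    obtain ⟨r, rfl⟩ := Ideal.Quotient.mk_surjective y
    exact Ideal.Quotient.eq_zero_iff_mem.2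
      ((p.isPrime.mem_or_mem (Ideal.Quotient.eq_zero_iff_mem.1 hy)).resolve_left hxp)
  have hS := hx.smulShortComplex_shortExact
  let δ : Ext A C i →ₗ[R] Ext (ModuleCat.of R (QuotSMulTop x A)) C (i + 1) :=
    hS.extClass.precompOfLinear R C (add_comm 1 i)
  have hle : x • ⊤ ≤ LinearMap.ker δ := by
    rintro _ ⟨e, -, rfl⟩
    change hS.extClass.comp (x • e) (add_comm 1 i) = 0
    rw [← smul_id_comp_ext x e]
    exact hS.extClass_comp_assoc e
  have hinj : Function.Injective ((x • ⊤ : Submodule R (Ext A C i)).liftQ δ hle) := by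
    rw [← LinearMap.ker_eq_bot, Submodule.ker_liftQ, ← le_bot_iff, Submodule.map_le_iff_le_comap]
    intro e he
    obtain ⟨e', he'⟩ := Ext.contravariant_sequence_exact₁ hS C e (add_comm 1 i) he
    have h : e = x • (show Ext A C i from e') := he'.symm.trans (smul_id_comp_ext x e')
    rw [h, Submodule.mem_comap, Submodule.mem_bot, Submodule.mkQ_apply,
      Submodule.Quotient.mk_eq_zero]
    exact Submodule.smul_mem_pointwise_smul _ _ _ Submodule.mem_top
  have hq : q ∈ Module.support R (QuotSMulTop x (Ext A C i)) := by
    rw [Module.support_quotSMulTop]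
    exact ⟨Module.mem_support_mono hpq.1.le hp, by simpa using hxq⟩
  obtain ⟨r, hr, hrq, h⟩ := exists_prime_mem_support_ext (QuotSMulTop x A)
    (Module.support_subset_of_injective _ hinj hq)
  rw [Module.support_quotSMulTop] at hr
  have hpr : p < r := by
    refine lt_of_le_of_ne ?_ fun h ↦ hxp (h ▸ by simpa using hr.2)
    have := Module.annihilator_le_of_mem_support hr.1
    rwa [Ideal.annihilator_quotient] at this
  obtain rfl | hlt := hrq.eq_or_lt
  · exact h
  · exact (hpq.2 hpr hlt).elim

theorem mem_support_ext_of_height (hC : Module.annihilator R C = ⊥) {n : ℕ} {q : PrimeSpectrum R}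
    (hq : Order.height q = n) :
    q ∈ Module.support R (Ext (ModuleCat.of R (R ⧸ q.asIdeal)) C n) := by
  induction n generalizing q with
  | zero =>
    -- In height zero, faithfulness makes `q` minimal over the annihilator of `C`, hence associated
    -- to `C`; this gives a map from `R/q` to `C` whose annihilator lies in `q`.
    have hmin : q.asIdeal ∈ (Module.annihilator R C).minimalPrimes := by
      rw [hC]
      refine ⟨⟨q.isPrime, bot_le⟩, fun J hJ hJq ↦ ?_⟩
      exact (Order.height_eq_zero.1 hq) (b := ⟨J, hJ.1⟩) hJq
    obtain ⟨-, x, hx⟩ := isAssociatedPrime_iff.1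
      (Module.associatedPrimes.minimalPrimes_annihilator_subset_associatedPrimes R C hmin)
    have hmem : ∀ r, r ∈ q.asIdeal ↔ r • x = 0 := fun r ↦ by
      rw [hx, Submodule.mem_colon_singleton, Submodule.mem_bot]
    let φ : (R ⧸ q.asIdeal) →ₗ[R] C :=
      q.asIdeal.liftQ (LinearMap.toSpanSingleton R C x) fun r hr ↦ (hmem r).1 hr
    have hφ : φ (Submodule.Quotient.mk 1) = x := by
      change LinearMap.toSpanSingleton R C x 1 = x
      simp
    rw [Module.mem_support_iff']
    refine ⟨Ext.mk₀ (ModuleCat.ofHom φ), fun r hr h ↦ hr ?_⟩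
    rw [← Ext.mk₀_smul, Ext.mk₀_eq_zero_iff] at h
    have h1 := congr($h (Submodule.Quotient.mk 1 : R ⧸ q.asIdeal))
    rw [hmem, ← hφ]
    exact h1
  | succ n ih =>
    obtain ⟨-, ⟨p, hpq, hp⟩, hle⟩ := Order.height_eq_coe_add_one_iff.1 (by simpa using hq)
    refine mem_support_ext_succ_of_covBy ⟨hpq, fun r hpr hrq ↦ ?_⟩ (ih hp)
    have := (Order.height_add_one_le hpr).trans (hle r hrq)
    rw [hp] at this
    exact absurd this (by norm_cast; omega)

/-- A faithful finitely generated module `C` satisfies `Ext^n(k, C) ≠ 0` for `n = dim R`. -/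
theorem nontrivial_ext_of_ringKrullDim [IsLocalRing R] (hC : Module.annihilator R C = ⊥) {n : ℕ}
    (hn : ringKrullDim R = n) : Nontrivial (Ext (ModuleCat.of R (ResidueField R)) C n) := by
  have hht : Order.height (closedPoint R) = n := by
    rw [← PrimeSpectrum.height_eq_orderHeight]
    rw [← maximalIdeal_height_eq_ringKrullDim] at hn
    exact_mod_cast hn
  have h : ∀ I : Ideal R, (closedPoint R).asIdeal = I →
      closedPoint R ∈ Module.support R (Ext (ModuleCat.of R (R ⧸ I)) C n) := by
    rintro _ rfl
    exact mem_support_ext_of_height hC hht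
  have h' := Module.nonempty_support_iff.1 ⟨_, h (maximalIdeal R) rfl⟩
  exact h'

end Bass

end LocalAlg

end

noncomputable section

namespace LocalAlg

open CategoryTheory CategoryTheory.Abelian IsLocalRing

/-! ### Assembly of the proof. -/

section Main

variable {R : Type u} [CommRing R]

theorem IsSemidualizing.annihilator_eq_bot {C : Type u} [AddCommGroup C] [Module R C]
    (hC : IsSemidualizing R C) : Module.annihilator R C = ⊥ :=
  (Submodule.eq_bot_iff _).2 fun a ha ↦ hC.homothety_bijective.1 <| by
    ext c
    simpa using Module.mem_annihilator.1 ha c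

/-- `R ≅ Hom(C, C)`, so this is the comparison with `L = C`; it gives depth of `R` at least that of
`C`. -/
theorem IsSemidualizing.subsingleton_ext_ring [IsNoetherianRing R] {C : Type u} [AddCommGroup C] [Module R C]
    (hC : IsSemidualizing R C) {Y : ModuleCat.{u} R} {d : ℕ}
    (hY : ∀ i < d, Subsingleton (Ext Y (ModuleCat.of R C) i)) {i : ℕ} (hi : i < d) :
    Subsingleton (Ext Y (ModuleCat.of R R) i) := by
  have := hC.finite
  have : Module.Finite R (ModuleCat.of R C) := hC.finite
  have h := subsingleton_ext_dual hY hi (L := ModuleCat.of R C) hC.ext_self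
  let η : ModuleCat.of R R ≅ ModuleCat.of R (C →ₗ[R] C) :=
    (LinearEquiv.ofBijective (LinearMap.lsmul R C : R →ₗ[R] (C →ₗ[R] C))
      hC.homothety_bijective).toModuleIso
  refine subsingleton_of_forall_eq 0 fun e ↦ ?_
  have h0 : e.comp (Ext.mk₀ η.hom) (add_zero i) = 0 := h.elim _ _
  rw [← Ext.comp_mk₀_id e, ← η.hom_inv_id, ← Ext.mk₀_comp_mk₀, ← Ext.comp_assoc_of_third_deg_zero,
    h0, Ext.zero_comp]

variable [IsLocalRing R]

theorem length_ne_top_of_support [IsNoetherianRing R] (X : Type u) [AddCommGroup X] [Module R X]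
    [hX : Module.Finite R X] (h : Module.support R X ⊆ {closedPoint R}) :
    Module.length R X ≠ ⊤ := by
  induction hX using IsNoetherianRing.induction_on_isQuotientEquivQuotientPrime R with
  | subsingleton N => simp
  | quotient N p f =>
    have hp : p = closedPoint R := h (by
      rw [f.support_eq, Module.mem_support_iff_of_finite, Ideal.annihilator_quotient])
    have hm : Module.length R (R ⧸ maximalIdeal R) = 1 := length_residueField
    obtain rfl := hp
    rw [f.length_eq]
    exact ne_of_eq_of_ne hm ENat.one_ne_top
  | exact N₁ N₂ N₃ f g hf hg hfg h₁ h₃ =>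
    rw [Module.support_of_exact hfg hf hg, Set.union_subset_iff] at h
    rw [Module.length_eq_add_of_exact f g hf hg hfg]
    exact WithTop.add_ne_top.2 ⟨h₁ h.1, h₃ h.2⟩

/-- Any `n` mapping to `1` under a surjection `N → k` works. This bounds `E = Ext^d(k, C)` by a Hom
module that duality computes. -/
theorem exists_eval_surjective (N : Type u) [AddCommGroup N] [Module R N] [Module.Finite R N]
    [Nontrivial N] {E : Type u} [AddCommGroup E] [Module R E]
    (hE : ∀ a ∈ maximalIdeal R, ∀ v : E, a • v = 0) :
    ∃ n : N, Function.Surjective (LinearMap.applyₗ n : (N →ₗ[R] E) →ₗ[R] E) := by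
  obtain ⟨q, hq⟩ := exists_surjective_to_residueField (R := R) N
  obtain ⟨n, hn⟩ := hq 1
  refine ⟨n, fun v ↦ ?_⟩
  obtain ⟨ψ, hψ⟩ := exists_residueField_map v fun a ha ↦ hE a ha v
  exact ⟨ψ.comp q, by simp [hn, hψ]⟩

theorem smul_ext_residueField_eq_zero (X : ModuleCat.{u} R) {i : ℕ} {a : R}
    (ha : a ∈ maximalIdeal R) (v : Ext (ModuleCat.of R (ResidueField R)) X i) : a • v = 0 :=
  @isTorsionBySet_ext R _ _ X _ _ i v ⟨a, ha⟩

theorem length_ext_le_one_of_moduleType {M : Type u} [AddCommGroup M] [Module R M]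
    (htype : moduleType R M = 1) {t : ℕ} (ht : depth R M = t) :
    Nontrivial (Ext (ModuleCat.of R (ResidueField R)) (ModuleCat.of R M) t) ∧
      Module.length R (Ext (ModuleCat.of R (ResidueField R)) (ModuleCat.of R M) t) ≤ 1 := by
  rw [moduleType, ht, ENat.toNat_natCast] at htype
  obtain ⟨v, hv, h⟩ := finrank_eq_one_iff'.1 htype
  refine ⟨⟨v, 0, hv⟩, ?_⟩
  obtain ⟨φ, hφ⟩ := exists_residueField_map v fun a ha ↦
    smul_ext_residueField_eq_zero (ModuleCat.of R M) ha v
  rw [← length_residueField (R := R)]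
  refine Module.length_le_of_surjective φ fun w ↦ ?_
  obtain ⟨c, rfl⟩ := h w
  obtain ⟨b, rfl⟩ := residue_surjective c
  refine ⟨residue R b, ?_⟩
  have h1 : residue R b = b • (1 : ResidueField R) := by
    rw [Algebra.smul_def, ResidueField.algebraMap_eq, mul_one]
  rw [h1, map_smul, hφ, ← h1]
  exact ((isTorsionBySet_ext R M t).mk_smul b v).symm

theorem exists_isWeaklyRegular_of_depth_eq {M : Type u} [AddCommGroup M] [Module R M] {t : ℕ}
    (ht : depth R M = t) : ∃ rs : List R, (∀ r ∈ rs, r ∈ maximalIdeal R) ∧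
      RingTheory.Sequence.IsWeaklyRegular M rs ∧ rs.length = t := by
  by_contra! hne
  have hle : ∀ rs : List R, (∀ r ∈ rs, r ∈ maximalIdeal R) →
      RingTheory.Sequence.IsWeaklyRegular M rs → rs.length < t := by
    intro rs h1 h2
    refine lt_of_le_of_ne ?_ (hne rs h1 h2)
    have : (rs.length : ℕ∞) ≤ depth R M :=
      le_iSup₂_of_le (f := fun (rs : List R) (_ : (∀ r ∈ rs, r ∈ maximalIdeal R) ∧
        RingTheory.Sequence.IsWeaklyRegular M rs) ↦ (rs.length : ℕ∞)) rs ⟨h1, h2⟩ le_rfl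
    rw [ht] at this
    exact_mod_cast this
  have h0 : 0 < t := hle [] (by simp) (.nil R M)
  have : depth R M ≤ (t - 1 : ℕ) := iSup₂_le fun rs h ↦ by
    have := hle rs h.1 h.2
    exact_mod_cast (by omega : rs.length ≤ t - 1)
  rw [ht] at this
  have : t ≤ t - 1 := by exact_mod_cast this
  omega

theorem smul_top_lt_top (M : Type u) [AddCommGroup M] [Module R M] [Module.Finite R M]
    [Nontrivial M] : maximalIdeal R • (⊤ : Submodule R M) < ⊤ :=
  lt_top_iff_ne_top.2 fun h ↦ top_ne_bot (α := Submodule R M)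
    (Submodule.eq_bot_of_le_smul_of_le_jacobson_bot _ _ Module.Finite.fg_top h.ge
      (maximalIdeal_le_jacobson _))

theorem support_residueField :
    Module.support R (ModuleCat.of R (ResidueField R)) =
      PrimeSpectrum.zeroLocus (maximalIdeal R : Set R) := by
  have h : Module.annihilator R (R ⧸ maximalIdeal R) = maximalIdeal R := Ideal.annihilator_quotient
  have h' := Module.support_eq_zeroLocus (R := R) (M := R ⧸ maximalIdeal R)
  rw [h] at h'
  exact h'

variable [IsNoetherianRing R]

instance : Module.Finite R (ModuleCat.of R (ResidueField R)) :=
  inferInstanceAs (Module.Finite R (ResidueField R))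

/-- Multiplication by a regular element `r` gives `0 → X → X → X/rX → 0`, which raises the codegree
by one and lowers the dimension by one. -/
theorem IsDualizedBy.exists_quotient {C : ModuleCat.{u} R} {d j : ℕ} (rs : List R)
    (X : ModuleCat.{u} R) [Module.Finite R X]
    (hmem : ∀ r ∈ rs, r ∈ maximalIdeal R) (hreg : RingTheory.Sequence.IsRegular X rs)
    (h : ∀ Y : ModuleCat.{u} R, Module.length R Y ≠ ⊤ → IsDualizedBy C Y d j X) :
    ∃ X' : ModuleCat.{u} R, Module.Finite R X' ∧ Nontrivial X' ∧
      Module.supportDim R X' + rs.length = Module.supportDim R X ∧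
      ∀ Y : ModuleCat.{u} R, Module.length R Y ≠ ⊤ → IsDualizedBy C Y d (j + rs.length) X' := by
  induction rs generalizing X j with
  | nil => exact ⟨X, inferInstance, hreg.nontrivial, by simp, h⟩
  | cons r rs ih =>
    rw [RingTheory.Sequence.isRegular_cons_iff] at hreg
    obtain ⟨X', h1, h2, h3, h4⟩ := ih (j := j + 1) (ModuleCat.of R (QuotSMulTop r X))
      (fun s hs ↦ hmem s (List.mem_cons_of_mem _ hs)) hreg.2
      fun Y hY ↦ .of_shortExact hreg.1.smulShortComplex_shortExact (h Y hY) (h Y hY)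
    refine ⟨X', h1, h2, ?_, fun Y hY ↦ ?_⟩
    · rw [← Module.supportDim_quotSMulTop_succ_eq_supportDim hreg.1 (hmem r List.mem_cons_self),
        ← h3, List.length_cons, Nat.cast_succ, add_assoc]
    · have := h4 Y hY
      rwa [add_assoc, add_comm 1] at this

theorem exists_ringKrullDim_eq : ∃ n : ℕ, ringKrullDim R = n := by
  obtain ⟨D, hD⟩ := WithBot.ne_bot_iff_exists.1 (ringKrullDim_ne_bot (R := R))
  have h : ringKrullDim R ≠ ⊤ := ringKrullDim_lt_top.ne
  rw [← hD] at h
  obtain ⟨n, rfl⟩ := ENat.ne_top_iff_exists.1 fun h' : D = ⊤ ↦ h (by rw [h']; rfl)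
  exact ⟨n, hD.symm⟩

theorem depth_le_supportDim (M : Type u) [AddCommGroup M] [Module R M] [Module.Finite R M]
    [Nontrivial M] : (depth R M : WithBot ℕ∞) ≤ Module.supportDim R M := by
  obtain ⟨D, hD⟩ := WithBot.ne_bot_iff_exists.1
    (Module.supportDim_ne_bot_of_nontrivial (R := R) (M := M))
  rw [← hD, WithBot.coe_le_coe]
  refine iSup₂_le fun rs h ↦ ?_
  have hreg :=
    (isRegular_iff_isWeaklyRegular_of_subset_maximalIdeal (M := M) h.1).2 h.2
  have h1 := Module.supportDim_add_length_eq_supportDim_of_isRegular rs hreg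
  have := hreg.quot_ofList_smul_nontrivial ⊤
  obtain ⟨D', hD'⟩ := WithBot.ne_bot_iff_exists.1 (Module.supportDim_ne_bot_of_nontrivial (R := R)
    (M := M ⧸ Ideal.ofList rs • (⊤ : Submodule R M)))
  rw [← hD, ← hD'] at h1
  have h2 : D' + (rs.length : ℕ∞) = D := by exact_mod_cast h1
  rw [← h2]
  exact le_add_self

/-- If `k` has nonzero `Ext` into the semidualizing module `C` only in degree `d`, then `R` is
Cohen-Macaulay. -/
theorem IsSemidualizing.isCohenMacaulay {C : Type u} [AddCommGroup C] [Module R C]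
    (hC : IsSemidualizing R C) {d : ℕ}
    (hlt : ∀ i < d, Subsingleton (Ext (ModuleCat.of R (ResidueField R)) (ModuleCat.of R C) i))
    (hgt : ∀ i, d < i →
      Subsingleton (Ext (ModuleCat.of R (ResidueField R)) (ModuleCat.of R C) i)) :
    IsCohenMacaulay R R := by
  have : Module.Finite R (ModuleCat.of R C) := hC.finite
  obtain ⟨n, hn⟩ := exists_ringKrullDim_eq (R := R)
  have hnt := nontrivial_ext_of_ringKrullDim (C := ModuleCat.of R C) hC.annihilator_eq_bot hn
  have hle : n ≤ d := by
    by_contra h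
    exact not_subsingleton _ (hgt n (by omega))
  refine ⟨inferInstance, inferInstance, le_antisymm (depth_le_supportDim R) ?_⟩
  obtain ⟨rs, hlen, hmem, hreg⟩ := ModuleCat.exists_isRegular_of_exists_subsingleton_ext
    (maximalIdeal R) d (ModuleCat.of R R) (smul_top_lt_top R) (ModuleCat.of R (ResidueField R))
    support_residueField fun i hi ↦ hC.subsingleton_ext_ring hlt hi
  rw [Module.supportDim_self_eq_ringKrullDim, hn]
  have h1 : (rs.length : ℕ∞) ≤ depth R R :=
    le_iSup₂_of_le (f := fun (rs : List R) (_ : (∀ r ∈ rs, r ∈ maximalIdeal R) ∧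
      RingTheory.Sequence.IsWeaklyRegular R rs) ↦ (rs.length : ℕ∞)) rs
      ⟨hmem, hreg.toIsWeaklyRegular⟩ le_rfl
  have h2 : (n : ℕ∞) ≤ depth R R := le_trans (by exact_mod_cast hle.trans hlen.ge) h1
  exact_mod_cast h2

/-- If a Cohen-Macaulay module of type one has finite `G_C`-dimension for some semidualizing
module `C`, then the ring is Cohen-Macaulay. -/
theorem IsSemidualizing.isCohenMacaulay_of_gcDim_lt_top
    {C : Type u} [AddCommGroup C] [Module R C] (hC : IsSemidualizing R C)
    {M : Type u} [AddCommGroup M] [Module R M] (hM : IsCohenMacaulay R M)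
    (htype : moduleType R M = 1) (hdim : gcDim R C M < ⊤) : IsCohenMacaulay R R := by
  have := hM.finite
  have := hM.nontrivial
  have : Module.Finite R (ModuleCat.of R C) := hC.finite
  have : Module.Finite R (ModuleCat.of R M) := hM.finite
  obtain ⟨n, hn⟩ := exists_ringKrullDim_eq (R := R)
  let K := ModuleCat.of R (ResidueField R)
  obtain ⟨d, hd, hlt⟩ : ∃ d, Nontrivial (Ext K (ModuleCat.of R C) d) ∧
      ∀ i < d, Subsingleton (Ext K (ModuleCat.of R C) i) := by
    classical
    have hex : ∃ d, Nontrivial (Ext K (ModuleCat.of R C) d) :=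
      ⟨n, nontrivial_ext_of_ringKrullDim (C := ModuleCat.of R C) hC.annihilator_eq_bot hn⟩
    exact ⟨Nat.find hex, Nat.find_spec hex, fun i hi ↦
      not_nontrivial_iff_subsingleton.1 (Nat.find_min hex hi)⟩
  obtain ⟨t, ht⟩ : ∃ t : ℕ, depth R M = t := by
    have h1 := (depth_le_supportDim (R := R) M).trans (Module.supportDim_le_ringKrullDim R M)
    rw [hn] at h1
    have h2 : depth R M ≤ (n : ℕ∞) := by exact_mod_cast h1
    exact ⟨_, (ENat.natCast_toNat (ne_top_of_le_ne_top (ENat.natCast_ne_top n) h2)).symm⟩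
  obtain ⟨rs, hmem, hweak, hlen⟩ := exists_isWeaklyRegular_of_depth_eq ht
  have hreg := (isRegular_iff_isWeaklyRegular_of_subset_maximalIdeal (M := M) hmem).2 hweak
  have hdepth : ∀ i < t, Subsingleton (Ext K (ModuleCat.of R M) i) := hlen ▸
    ModuleCat.subsingleton_ext_of_exists_isRegular (maximalIdeal R) K support_residueField.subset
      (ModuleCat.of R M) (smul_top_lt_top M) rs hmem hreg
  obtain ⟨hnt, hl1⟩ := length_ext_le_one_of_moduleType htype ht
  obtain ⟨m, hm⟩ : ∃ m, GCDimLE R C M m := by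
    obtain ⟨m, hm⟩ := iInf_lt_iff.1 hdim
    obtain ⟨h, -⟩ := iInf_lt_iff.1 hm
    exact ⟨m, h⟩
  -- The subtraction is truncated, so nothing is assumed yet about `t ≤ d`.
  have hres : HasReflexiveResolution (ModuleCat.of R C) (d - t) (ModuleCat.of R M) :=
    (GCDimLE.hasReflexiveResolution (C := ModuleCat.of R C) hm).of_depth hlt hd
      fun i hi ↦ hdepth i (by omega)
  have hdual : ∀ Y : ModuleCat.{u} R, Module.length R Y ≠ ⊤ →
      IsDualizedBy (ModuleCat.of R C) Y d (d - t) (ModuleCat.of R M) := fun Y hY ↦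
    hres.isDualizedBy fun i hi ↦ subsingleton_ext_of_length (hlt i hi) Y hY
  have hK : Module.length R K ≠ ⊤ := ne_of_eq_of_ne length_residueField ENat.one_ne_top
  -- If `t > d`, then `M` is totally reflexive and nonzero, and duality makes the zero group
  -- `Ext^d(k, M)` surject onto `Hom(Hom(M, C), Ext^d(k, C)) ≠ 0`.
  have htd : t ≤ d := by
    by_contra hlt'
    have h0 : d - t = 0 := by omega
    rw [h0] at hres
    have hlow : Subsingleton (Ext K (ModuleCat.of R M) d) := hdepth d (by omega)
    have h1 := hdual K hK
    rw [h0] at h1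
    have hN : Nontrivial (Ext (ModuleCat.of R M) (ModuleCat.of R C) 0) := by
      by_contra hN
      rw [not_nontrivial_iff_subsingleton] at hN
      obtain ⟨x, hx⟩ := exists_ne (0 : M)
      refine hx (hres.eval_bijective.1 (LinearMap.ext fun f ↦ ?_))
      have hf : ModuleCat.ofHom f = 0 := (Ext.mk₀_bijective _ _).1 (hN.elim _ _)
      have hfx : f x = 0 := congr($hf x)
      rw [map_zero]
      exact hfx
    obtain ⟨v, hv⟩ := exists_eval_surjective (Ext (ModuleCat.of R M) (ModuleCat.of R C) 0)
      fun a ha (v : Ext K (ModuleCat.of R C) d) ↦ smul_ext_residueField_eq_zero _ ha v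
    obtain ⟨w, hw⟩ := exists_ne (0 : Ext K (ModuleCat.of R C) d)
    obtain ⟨φ, rfl⟩ := hv w
    obtain ⟨e, he⟩ := h1.surj d rfl φ
    refine hw ((he v).symm.trans ?_)
    rw [hlow.elim e 0, Ext.zero_comp]
  have htd' : t + (d - t) = d := by omega
  have hN : Nontrivial (Ext (ModuleCat.of R M) (ModuleCat.of R C) (d - t)) := by
    by_contra hN
    rw [not_nontrivial_iff_subsingleton] at hN
    obtain ⟨v, hv⟩ := exists_ne (0 : Ext K (ModuleCat.of R M) t)
    refine hv ((hdual K hK).inj t htd' v fun f ↦ ?_)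
    rw [hN.elim f 0, Ext.comp_zero]
  -- `Ext^t(k, M)` surjects onto `Hom(Ext^(d-t)(M, C), Ext^d(k, C))`, which surjects onto `Ext^d(k,
  -- C)` by a suitable evaluation.
  have hCtype : Module.length R (Ext K (ModuleCat.of R C) d) ≤ 1 := by
    obtain ⟨v, hv⟩ := exists_eval_surjective (Ext (ModuleCat.of R M) (ModuleCat.of R C) (d - t))
      fun a ha (v : Ext K (ModuleCat.of R C) d) ↦ smul_ext_residueField_eq_zero _ ha v
    refine (Module.length_le_of_surjective _ hv).trans (le_trans ?_ hl1)
    refine Module.length_le_of_surjective (Ext.bilinearCompOfLinear R K (ModuleCat.of R M)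
      (ModuleCat.of R C) t (d - t) d htd') fun φ ↦ ?_
    obtain ⟨e, he⟩ := (hdual K hK).surj t htd' φ
    exact ⟨e, LinearMap.ext he⟩
  obtain ⟨X, _, _, hXdim, hX⟩ := IsDualizedBy.exists_quotient rs (ModuleCat.of R M) hmem hreg hdual
  rw [hlen, show d - t + t = d by omega] at hX
  -- Here Cohen–Macaulayness of `M` enters: its dimension is `t`, so `X` has dimension zero.
  have hXlen : Module.length R X ≠ ⊤ := by
    refine length_ne_top_of_support X ?_
    rw [support_of_supportDim_eq_zero, PrimeSpectrum.zeroLocus_eq_singleton]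
    · rfl
    · obtain ⟨D, hD⟩ := WithBot.ne_bot_iff_exists.1
        (Module.supportDim_ne_bot_of_nontrivial (R := R) (M := X))
      have h1 : Module.supportDim R (ModuleCat.of R M) = (t : ℕ∞) := by rw [← ht, hM.depth_eq]
      rw [h1, hlen, ← hD] at hXdim
      have h2 : D + (t : ℕ∞) = 0 + t := by rw [zero_add]; exact_mod_cast hXdim
      rw [← hD, WithTop.add_right_cancel (ENat.natCast_ne_top t) h2]
      rfl
  exact hC.isCohenMacaulay hlt fun i hi ↦ subsingleton_ext_residueField_of_length hCtype hXlen
    (hX K hK).ext_zero (IsDualizedBy.length_le_length_ext hlt hCtype hXlen hX) hi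

end Main

end LocalAlg

end

theorem corollary3p5 (R : Type u) [CommRing R] [IsNoetherianRing R] [IsLocalRing R]
    (C : Type u) [AddCommGroup C] [Module R C] (hC : LocalAlg.IsSemidualizing R C)
    (M : Type u) [AddCommGroup M] [Module R M] (hM : LocalAlg.IsCohenMacaulay R M)
    (htype : LocalAlg.moduleType R M = 1) (hdim : LocalAlg.gcDim R C M < ⊤) :
    LocalAlg.IsCohenMacaulay R R :=
  hC.isCohenMacaulay_of_gcDim_lt_top hM htype hdim
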